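/- Let $p$ be a prime, let $k$ be a field of characteristic $p$ with a finite $p$-basis $u_1,\dots,u_r$ (the monomials $u^s$, $s\in[0,p-1]^r$, form a basis of $k$ over $k^p$), and let $k'\subset k$ be the $k^p$-span of the $u^s$ with $s\neq 0$. Let $E=k((t))$, with absolute Galois group $G_E$ and $t$-adic valuation $v$. Write $W_s(\cdot)$ for Witt vectors $(\lambda_0,\dots,\lambda_s)$ of length $s+1$ and $\mathrm{Fil}_dW_s(E)=\{f : p^{s-i}v(f_i)\ge -d \text{ for all } i\}$. Let $\delta:W_s(E)\to H^1(G_E,\mathbb Z/p^{s+1})\subset H^1(G_E,\mathbb Q/\mathbb Z)$ be the Artin–Schreier–Witt map $\delta(f)(\gamma)=\gamma(\nu)-\nu$, where $F(\nu)-\nu=f$. Let $\mathrm{Fil}_dH^1(G_E,\mathbb Q_p/\mathbb Z_p)=\bigcup_s\delta(\mathrm{Fil}_dW_s(E))$, and let $\mathrm{Fil}_dH^1(G_E,\mathbb Q/\mathbb Z)$ be its inverse image under the projection to the $p$-primary part. Let $\mathrm{Fil}_d\Omega^1_E=t^{-d}\bigl(\bigoplus_i k[[t]]\,du_i\oplus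 k[[t]]\,d\log t\bigr)$ and $\mathrm{Gr}_d=\mathrm{Fil}_d/\mathrm{Fil}_{d-1}$. Put $F^sd(f_0,\dots,f_s)=\sum_i f_i^{p^{s-i}}\,d\log f_i$, where a term with $f_i=0$ is $0$. Let $d=np^m>0$ with $(n,p)=1$. Let $B\mathrm{Gr}_d\Omega^1_E\subset\mathrm{Gr}_d\Omega^1_E$ be the subgroup of classes of $t^{-d}(\alpha+\beta\,d\log t)$ with $\alpha\in B_{m+1}\Omega^1_k$, $\beta\in k^{p^m}$ and $n\,C^m(\alpha)+d(C^m(\beta))=0$. Here $C$ is the Cartier operator, $C^m(a^{p^m})=a$, $B_0\Omega^1_k=0$, and $B_{j+1}\Omega^1_k$ is the inverse image of $C^{-1}(B_j\Omega^1_k)$ in the closed forms. Fix a sign $\varepsilon\in\{1,-1\}$. Then the following hold. (1) The rule $(\lambda_0,\dots,\lambda_m)\mapsto\delta(\lambda_0t^{-n},\lambda_1t^{-np},\dots,\lambda_mt^{-np^m})$ induces an isomorphism $\bar\delta_d:W_m(k)/pW_m(k)\to\mathrm{Gr}_dH^1(G_E,\mathbb Q/\mathbb Z)$. (2) There is a unique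 homomorphism (the refined Swan map) $\psi_d:\mathrm{Gr}_dH^1(G_E,\mathbb Q/\mathbb Z)\to\mathrm{Gr}_d\Omega^1_E$ such that $\psi_d\circ\mathrm{gr}_d(\delta)=\varepsilon\cdot\mathrm{gr}_d(F^sd)$ on $\mathrm{Fil}_dW_s(E)$ for all $s\ge 0$. (3) The composite $\psi_d\circ\bar\delta_d$ is an isomorphism of $W_m(k)/pW_m(k)$ onto $B\mathrm{Gr}_d\Omega^1_E$. (4) Every element of $W_m(k)/pW_m(k)$ has a unique representative $(\lambda_0,\dots,\lambda_m)\in W_m(k)$ with $\lambda_0\in k$ and $\lambda_1,\dots,\lambda_m\in k'$, and for it $$\psi_d\circ\bar\delta_d(\lambda_0,\dots,\lambda_m)=\varepsilon\cdot t^{-d}\Bigl(-n\lambda_0^{p^m}\,d\log t+\sum_{0\le j\le m}\lambda_j^{p^{m-j}}\,d\log\lambda_j\Bigr).$$ (5) Every element of $B\mathrm{Gr}_d\Omega^1_E$ can be written as the class of $$t^{-d}\Bigl(-n\lambda_0^{p^m}\,d\log t+\sum_{0\le j\le m}\lambda_j^{p^{m-j}}\,d\log\lambda_j\Bigr)$$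 with unique $\lambda_0\in k$ and $\lambda_1,\dots,\lambda_m\in k'$. -/

import Mathlib

set_option linter.unusedSectionVars false

noncomputable section

namespace RefinedSwan

section Witt

variable {p : ℕ} [Fact p.Prime]

/-- The ring `W_m(R)` of Witt vectors `(x_0, …, x_m)` with `m + 1` components. -/
abbrev W (p m : ℕ) (R : Type*) : Type _ := TruncatedWittVector p (m + 1) R

/-- The ring homomorphism `(x_0, x_1, …) ↦ (f x_0, f x_1, …)` on truncated Witt vectors. -/
def truncMap {R S : Type*} [CommRing R] [CommRing S] (n : ℕ) (f : R →+* S) :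
    TruncatedWittVector p n R →+* TruncatedWittVector p n S where
  toFun x := TruncatedWittVector.mk p fun i => f (x.coeff i)
  map_one' := by
    rw [← map_one (WittVector.truncate n), ← map_one (WittVector.truncate n),
      ← map_one (WittVector.map f)]
    ext i
    simp [WittVector.map_coeff, -map_one]
  map_zero' := by
    ext i; simp
  map_mul' x y := by
    obtain ⟨x, rfl⟩ := WittVector.truncate_surjective p n R x
    obtain ⟨y, rfl⟩ := WittVector.truncate_surjective p n R y
    have h : ∀ z : WittVector p R, (TruncatedWittVector.mk p fun i =>
        f ((WittVector.truncate n z).coeff i)) = WittVector.truncate n (WittVector.map f z) := by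
      intro z; ext i; simp [WittVector.map_coeff]
    rw [← map_mul, h, h, h, map_mul, map_mul]
  map_add' x y := by
    obtain ⟨x, rfl⟩ := WittVector.truncate_surjective p n R x
    obtain ⟨y, rfl⟩ := WittVector.truncate_surjective p n R y
    have h : ∀ z : WittVector p R, (TruncatedWittVector.mk p fun i =>
        f ((WittVector.truncate n z).coeff i)) = WittVector.truncate n (WittVector.map f z) := by
      intro z; ext i; simp [WittVector.map_coeff]
    rw [← map_add, h, h, h, map_add, map_add]

theorem coeff_truncMap {R S : Type*} [CommRing R] [CommRing S] {n : ℕ} (f : R →+* S)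
    (x : TruncatedWittVector p n R) (i : Fin n) : (truncMap n f x).coeff i = f (x.coeff i) := rfl

theorem truncMap_truncate {R S : Type*} [CommRing R] [CommRing S] {n : ℕ} (f : R →+* S)
    (x : WittVector p R) :
    truncMap n f (WittVector.truncate n x) = WittVector.truncate n (WittVector.map f x) := by
  ext i; simp [coeff_truncMap, WittVector.map_coeff]

/-- Frobenius minus the identity on `W_{n-1}(R)`. -/
def wp (R : Type*) [CommRing R] [CharP R p] (n : ℕ) :
    TruncatedWittVector p n R →+ TruncatedWittVector p n R :=
  (truncMap n (frobenius R p)).toAddMonoidHom - AddMonoidHom.id _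

theorem wp_apply {R : Type*} [CommRing R] [CharP R p] {n : ℕ} (x : TruncatedWittVector p n R) :
    wp R n x = truncMap n (frobenius R p) x - x := rfl

theorem wp_surjective {L : Type*} [Field L] [CharP L p] [IsSepClosed L] (n : ℕ) :
    Function.Surjective (wp (p := p) L n) := by
  have key : ∀ (n : ℕ) (f : WittVector p L), ∃ ν g : WittVector p L,
      WittVector.frobenius ν - ν - f = WittVector.verschiebung^[n] g := by
    intro n f
    induction n with
    | zero => exact ⟨0, -f, by simp⟩
    | succ n ih =>
      obtain ⟨ν, g, h⟩ := ih
      obtain ⟨a, ha⟩ := IsSepClosed.exists_root_C_mul_X_pow_add_C_mul_X_add_C' p p (1 : L) (-1)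
        (g.coeff 0) dvd_rfl (Fact.out : p.Prime).two_le (by simp)
      have hV : ∀ x y : WittVector p L, WittVector.verschiebung^[n] (x + y) =
          WittVector.verschiebung^[n] x + WittVector.verschiebung^[n] y :=
        fun x y => iterate_map_add _ _ _ _
      have hVs : ∀ x y : WittVector p L, WittVector.verschiebung^[n] (x - y) =
          WittVector.verschiebung^[n] x - WittVector.verschiebung^[n] y :=
        fun x y => iterate_map_sub _ _ _ _
      have hF : ∀ x : WittVector p L, WittVector.frobenius (WittVector.verschiebung^[n] x) =
          WittVector.verschiebung^[n] (WittVector.frobenius x) := by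
        intro x
        exact (((WittVector.verschiebung_frobenius_comm (p := p) (R := L)).iterate_left n) x).symm
      set T := WittVector.teichmuller p a
      set g' := g + (WittVector.frobenius T - T)
      have hg' : g'.coeff 0 = 0 := by
        have : g'.coeff 0 = WittVector.constantCoeff g' := rfl
        rw [this, map_add, map_sub]
        simp only [WittVector.constantCoeff_apply, WittVector.coeff_frobenius_charP, T,
          WittVector.teichmuller_coeff_zero]
        linear_combination ha
      refine ⟨ν + WittVector.verschiebung^[n] T, g'.shift 1, ?_⟩
      have h2 : g' = WittVector.verschiebung (g'.shift 1) := by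
        have h0 : g'.shift 0 = g' := by ext i; simp [WittVector.shift_coeff]
        have := WittVector.verschiebung_shift g' 0 (by intro i hi; interval_cases i; exact hg')
        rw [h0] at this
        exact this.symm
      rw [Function.iterate_succ_apply, ← h2, map_add, hF]
      simp only [g', hV, hVs]
      rw [← h]; abel
  intro f
  obtain ⟨f, rfl⟩ := WittVector.truncate_surjective p n L f
  obtain ⟨ν, g, h⟩ := key n f
  refine ⟨WittVector.truncate n ν, ?_⟩
  rw [wp_apply, truncMap_truncate, ← WittVector.frobenius_eq_map_frobenius, ← map_sub,
    ← sub_eq_zero, ← map_sub, h, ← RingHom.mem_ker, WittVector.mem_ker_truncate]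
  intro i hi
  exact WittVector.iterate_verschiebung_coeff_eq_zero g hi

/-- `ℤ/p^n = W_{n-1}(𝔽_p) → W_{n-1}(R)`. -/
def ofZMod (R : Type*) [CommRing R] [CharP R p] (n : ℕ) :
    ZMod (p ^ n) →+* TruncatedWittVector p n R :=
  (truncMap n (ZMod.castHom dvd_rfl R)).comp
    (TruncatedWittVector.zmodEquivTrunc p n : ZMod (p ^ n) →+* TruncatedWittVector p n (ZMod p))

theorem ofZMod_injective {R : Type*} [CommRing R] [CharP R p] [Nontrivial R] (n : ℕ) :
    Function.Injective (ofZMod (p := p) R n) := by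
  refine Function.Injective.comp (g := truncMap n (ZMod.castHom dvd_rfl R)) ?_
    (TruncatedWittVector.zmodEquivTrunc p n).injective
  intro x y h
  ext i
  have := congrArg (TruncatedWittVector.coeff i) h
  exact (ZMod.castHom dvd_rfl R).injective this

theorem wp_ofZMod {R : Type*} [CommRing R] [CharP R p] (n : ℕ) (j : ZMod (p ^ n)) :
    wp R n (ofZMod R n j) = 0 := by
  rw [wp_apply, sub_eq_zero]
  exact RingHom.congr_fun (Subsingleton.elim
    ((truncMap n (frobenius R p)).comp (ofZMod R n)) (ofZMod R n)) j

theorem exists_ofZMod {L : Type*} [Field L] [CharP L p] {n : ℕ} {x : TruncatedWittVector p n L}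
    (hx : wp L n x = 0) : ∃ j, ofZMod L n j = x := by
  have h : ∀ i, ∃ a : ZMod p, ZMod.castHom dvd_rfl L a = x.coeff i := by
    intro i
    rw [wp_apply, sub_eq_zero] at hx
    have h1 : (x.coeff i) ^ p = x.coeff i := congrArg (TruncatedWittVector.coeff i) hx
    have := (ZMod.algebra L p)
    have h2 : x.coeff i ∈ (⊥ : Subfield L) := (Subfield.mem_bot_iff_pow_eq_self (F := L) (p := p)).2 h1
    have h3 : (⊥ : Subfield L) ≤ (ZMod.castHom dvd_rfl L : ZMod p →+* L).fieldRange := bot_le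
    exact h3 h2
  choose a ha using h
  refine ⟨(TruncatedWittVector.zmodEquivTrunc p n).symm (TruncatedWittVector.mk p a), ?_⟩
  ext i
  simp only [ofZMod, RingHom.comp_apply, RingHom.coe_coe, RingEquiv.apply_symm_apply]
  rw [coeff_truncMap, TruncatedWittVector.coeff_mk, ha]

end Witt

/-- The discrete group `ℚ/ℤ`. -/
abbrev QmodZ : Type := ℚ ⧸ (Int.castAddHom ℚ).range

/-- The embedding `ℤ/N → ℚ/ℤ`, `j ↦ j/N`. -/
def zmodToQmodZ (N : ℕ) [NeZero N] : ZMod N →+ QmodZ :=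
  ZMod.lift N ⟨(QuotientAddGroup.mk' _).comp
    ((zmultiplesHom ℚ) ((N : ℚ)⁻¹)), by
      simp only [AddMonoidHom.comp_apply, QuotientAddGroup.mk'_apply, QuotientAddGroup.eq_zero_iff,
        zmultiplesHom_apply]
      exact ⟨1, by simp [NeZero.ne]⟩⟩

/-- The character group `H¹(G_K, ℚ/ℤ) = Hom^cont(G_K, ℚ/ℤ)` of the absolute Galois group of `K`;
continuity is for the Krull topology on the group and the discrete topology on `ℚ/ℤ`. -/
def H1 (K : Type*) [Field K] : AddSubgroup (Additive Gal(SeparableClosure K/K) →+ QmodZ) where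
  carrier := {χ | IsLocallyConstant fun γ : Gal(SeparableClosure K/K) => χ (Additive.ofMul γ)}
  zero_mem' := IsLocallyConstant.const 0
  add_mem' h h' := IsLocallyConstant.add h h'
  neg_mem' h := IsLocallyConstant.neg h

section ASW

variable {p : ℕ} [Fact p.Prime] (K : Type*) [Field K] [CharP K p]

/-- The action of a Galois automorphism on `W_{n-1}(K^sep)`. -/
abbrev galW (n : ℕ) (γ : Gal(SeparableClosure K/K)) :
    TruncatedWittVector p n (SeparableClosure K) →+*
      TruncatedWittVector p n (SeparableClosure K) :=
  truncMap n (γ : SeparableClosure K →+* SeparableClosure K)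

/-- `ν` is a solution in `W_{n-1}(K^sep)` of `F(ν) - ν = f`. -/
def IsASWRoot {n : ℕ} (f : TruncatedWittVector p n K)
    (ν : TruncatedWittVector p n (SeparableClosure K)) : Prop :=
  truncMap n (frobenius (SeparableClosure K) p) ν - ν =
    truncMap n (algebraMap K (SeparableClosure K)) f

theorem exists_isASWRoot {n : ℕ} (f : TruncatedWittVector p n K) : ∃ ν, IsASWRoot K f ν :=
  wp_surjective n _

variable {K} in
theorem exists_period {n : ℕ} {f : TruncatedWittVector p n K}
    {ν : TruncatedWittVector p n (SeparableClosure K)} (h : IsASWRoot K f ν)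
    (γ : Gal(SeparableClosure K/K)) :
    ∃ j, ofZMod (SeparableClosure K) n j = galW K n γ ν - ν := by
  apply exists_ofZMod
  have h1 : truncMap n (frobenius (SeparableClosure K) p) (galW K n γ ν) =
      galW K n γ (truncMap n (frobenius (SeparableClosure K) p) ν) := by
    ext i
    simp [coeff_truncMap, frobenius_def]
  have h2 : galW K n γ (truncMap n (algebraMap K (SeparableClosure K)) f) =
      truncMap n (algebraMap K (SeparableClosure K)) f := by
    ext i
    simp [coeff_truncMap]
  have h3 := congrArg (galW K n γ) h
  rw [map_sub, ← h1, h2, ← h] at h3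
  rw [map_sub, wp_apply, wp_apply, h3, sub_self]

/-- A chosen solution of `F(ν) - ν = f`. -/
def aswRoot {n : ℕ} (f : TruncatedWittVector p n K) :
    TruncatedWittVector p n (SeparableClosure K) := (exists_isASWRoot K f).choose

/-- The element `γ(ν) - ν` of `ℤ/p^n = W_{n-1}(𝔽_p)`. -/
def aswPeriod {n : ℕ} (f : TruncatedWittVector p n K) (γ : Gal(SeparableClosure K/K)) :
    ZMod (p ^ n) :=
  (exists_period (exists_isASWRoot K f).choose_spec γ).choose

variable {K} in
theorem galW_ofZMod {n : ℕ} (γ : Gal(SeparableClosure K/K)) (j : ZMod (p ^ n)) :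
    galW K n γ (ofZMod (SeparableClosure K) n j) = ofZMod (SeparableClosure K) n j :=
  RingHom.congr_fun (Subsingleton.elim
    ((galW K n γ).comp (ofZMod (SeparableClosure K) n)) (ofZMod (SeparableClosure K) n)) j

variable {K} in
/-- The period does not depend on the choice of the solution `ν`. -/
theorem ofZMod_aswPeriod {n : ℕ} {f : TruncatedWittVector p n K}
    {ν : TruncatedWittVector p n (SeparableClosure K)} (h : IsASWRoot K f ν)
    (γ : Gal(SeparableClosure K/K)) :
    ofZMod (SeparableClosure K) n (aswPeriod K f γ) = galW K n γ ν - ν := by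
  have h0 := (exists_isASWRoot K f).choose_spec
  have h1 := (exists_period h0 γ).choose_spec
  have h2 : wp (SeparableClosure K) n (ν - (exists_isASWRoot K f).choose) = 0 := by
    rw [map_sub, sub_eq_zero]
    exact h.trans h0.symm
  obtain ⟨j, hj⟩ := exists_ofZMod h2
  have h3 := galW_ofZMod γ j
  rw [hj, map_sub] at h3
  refine h1.trans ?_
  rw [sub_eq_sub_iff_add_eq_add] at h3 ⊢
  rw [add_comm, ← h3.symm, add_comm]

variable {K} in
theorem aswPeriod_mul {n : ℕ} (f : TruncatedWittVector p n K) (γ γ' : Gal(SeparableClosure K/K)) :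
    aswPeriod K f (γ * γ') = aswPeriod K f γ + aswPeriod K f γ' := by
  obtain ⟨ν, h⟩ := exists_isASWRoot K f
  apply ofZMod_injective (R := SeparableClosure K) n
  have h1 : galW K n (γ * γ') ν = galW K n γ (galW K n γ' ν) := by
    ext i; simp [coeff_truncMap]
  have h2 := galW_ofZMod γ (aswPeriod K f γ')
  rw [ofZMod_aswPeriod h, map_sub] at h2
  rw [map_add, ofZMod_aswPeriod h, ofZMod_aswPeriod h, ofZMod_aswPeriod h, h1, ← h2]
  abel

variable {K} in
theorem aswPeriod_add {n : ℕ} (f f' : TruncatedWittVector p n K)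
    (γ : Gal(SeparableClosure K/K)) :
    aswPeriod K (f + f') γ = aswPeriod K f γ + aswPeriod K f' γ := by
  obtain ⟨ν, h⟩ := exists_isASWRoot K f
  obtain ⟨ν', h'⟩ := exists_isASWRoot K f'
  have h'' : IsASWRoot K (f + f') (ν + ν') := by
    unfold IsASWRoot at *
    rw [map_add, map_add, ← h, ← h']; abel
  apply ofZMod_injective (R := SeparableClosure K) n
  rw [map_add, ofZMod_aswPeriod h, ofZMod_aswPeriod h', ofZMod_aswPeriod h'', map_add]
  abel

variable {K} in
theorem isLocallyConstant_aswPeriod {n : ℕ} (f : TruncatedWittVector p n K) :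
    IsLocallyConstant (aswPeriod K f) := by
  obtain ⟨ν, h⟩ := exists_isASWRoot K f
  rw [IsLocallyConstant.iff_exists_open]
  intro γ
  let U : Set Gal(SeparableClosure K/K) := {σ | ∀ i, σ (ν.coeff i) = γ (ν.coeff i)}
  refine ⟨U, ?_, fun i => rfl, ?_⟩
  · have hU : U = ⋂ i, (fun σ => γ⁻¹ * σ) ⁻¹'
        (MulAction.stabilizer Gal(SeparableClosure K/K) (ν.coeff i) :
          Set Gal(SeparableClosure K/K)) := by
      ext σ
      simp only [U, Set.mem_ofPred_eq, Set.mem_iInter, Set.mem_preimage, SetLike.mem_coe,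
        MulAction.mem_stabilizer_iff, mul_smul, inv_smul_eq_iff]
      rfl
    rw [hU]
    refine isOpen_iInter_of_finite fun i => ?_
    exact (stabilizer_isOpen_of_isIntegral (K := K) (ν.coeff i)).preimage
      (continuous_const.mul continuous_id)
  · intro σ hσ
    apply ofZMod_injective (R := SeparableClosure K) n
    rw [ofZMod_aswPeriod h, ofZMod_aswPeriod h]
    congr 1
    ext i
    exact congrArg _ (hσ i)

/-- The Artin-Schreier-Witt homomorphism `δ : W_s(K) → H¹(G_K, ℤ/p^{s+1}) ⊂ H¹(G_K, ℚ/ℤ)`: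
`δ(f)(γ) = γ(ν) - ν ∈ ℤ/p^{s+1}`, where `F(ν) - ν = f`, and `ℤ/p^{s+1}` is embedded in `ℚ/ℤ` by
`j ↦ j/p^{s+1}`. -/
def delta (s : ℕ) : W p s K →+ H1 K where
  toFun f := ⟨AddMonoidHom.mk' (fun γ => zmodToQmodZ (p ^ (s + 1)) (aswPeriod K f γ.toMul))
      fun a b => by rw [toMul_add, aswPeriod_mul, map_add],
    (isLocallyConstant_aswPeriod f).comp (zmodToQmodZ (p ^ (s + 1)))⟩
  map_zero' := by
    have h : ∀ γ, aswPeriod K (0 : W p s K) γ = 0 := by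
      intro γ
      have := aswPeriod_add (0 : W p s K) 0 γ
      rw [add_zero] at this
      simpa using this
    ext γ
    simp [h]
  map_add' f f' := by
    ext γ
    simp [aswPeriod_add]

end ASW

section Filtration

variable {p : ℕ} [Fact p.Prime]

theorem coeff_teichmuller_mul {R : Type*} [CommRing R] [CharP R p] (a : R) (x : WittVector p R)
    (i : ℕ) : (WittVector.teichmuller p a * x).coeff i = a ^ p ^ i * x.coeff i := by
  have add_aux : ∀ (c : R) (y : WittVector p R) (i : ℕ),
      (WittVector.teichmuller p c + WittVector.verschiebung y).coeff i =
        (WittVector.teichmuller p c).coeff i + (WittVector.verschiebung y).coeff i := by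
    intro c y i
    refine WittVector.coeff_add_of_disjoint i _ _ fun n => ?_
    cases n with
    | zero => right; simp
    | succ n => left; exact WittVector.teichmuller_coeff_pos p c _ (Nat.succ_pos n)
  have split : ∀ x : WittVector p R,
      x = WittVector.teichmuller p (x.coeff 0) + WittVector.verschiebung (x.shift 1) := by
    intro x
    ext i
    rw [add_aux]
    cases i with
    | zero => simp
    | succ n =>
      rw [WittVector.teichmuller_coeff_pos p _ _ (Nat.succ_pos n),
        WittVector.verschiebung_coeff_succ, WittVector.shift_coeff, zero_add, add_comm]
  have frob : ∀ a : R, WittVector.frobenius (WittVector.teichmuller p a) =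
      WittVector.teichmuller p (a ^ p) := by
    intro a
    rw [WittVector.frobenius_eq_map_frobenius, WittVector.map_teichmuller, frobenius_def]
  have mul_split : ∀ (a : R) (x : WittVector p R), WittVector.teichmuller p a * x =
      WittVector.teichmuller p (a * x.coeff 0) +
        WittVector.verschiebung (WittVector.teichmuller p (a ^ p) * x.shift 1) := by
    intro a x
    conv_lhs => rw [split x]
    rw [mul_add, ← map_mul, ← frob, mul_comm _ (x.shift 1), WittVector.verschiebung_mul_frobenius,
      mul_comm (WittVector.verschiebung _)]
  induction i generalizing a x with
  | zero => simp [WittVector.mul_coeff_zero]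
  | succ i ih =>
    rw [mul_split, add_aux, WittVector.teichmuller_coeff_pos p _ _ (Nat.succ_pos i),
      WittVector.verschiebung_coeff_succ, zero_add, ih (a ^ p) (x.shift 1),
      WittVector.shift_coeff, ← pow_mul, ← pow_succ', add_comm 1 i]

/-- The field `E = k((t))`. -/
abbrev E (k : Type*) [Field k] : Type _ := LaurentSeries k

instance charP_E (k : Type*) [Field k] [CharP k p] : CharP (E k) p :=
  charP_of_injective_ringHom (HahnSeries.C_injective (Γ := ℤ) (R := k)) p

/-- The uniformizer `t` of `E = k((t))`. -/
def t (k : Type*) [Field k] : E k := HahnSeries.single 1 1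

theorem order_nonneg_iff {k : Type*} [Field k] (f : E k) :
    0 ≤ f.order ↔ f ∈ (HahnSeries.ofPowerSeries ℤ k).range := by
  constructor
  · intro h
    obtain ⟨N, hN⟩ := Int.eq_ofNat_of_zero_le h
    exact ⟨_, LaurentSeries.X_order_mul_powerSeriesPart hN.symm⟩
  · rintro ⟨g, rfl⟩
    by_contra! h
    have h0 : HahnSeries.ofPowerSeries ℤ k g ≠ 0 := by
      intro h0; rw [h0, HahnSeries.order_zero] at h; exact lt_irrefl _ h
    have h1 := mt HahnSeries.coeff_order_eq_zero.1 h0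
    apply h1
    rw [HahnSeries.ofPowerSeries_apply]
    apply HahnSeries.embDomain_of_notMem_range
    rintro ⟨a, ha⟩
    have ha' : (a : ℤ) = (HahnSeries.ofPowerSeries ℤ k g).order := ha
    omega

/-- `x ↦ [t]^d · F^s(x)` on `W_s(E)`. -/
def twist (k : Type*) [Field k] [CharP k p] (d s : ℕ) : W p s (E k) →+ W p s (E k) :=
  (AddMonoidHom.mulLeft (WittVector.truncate (s + 1) (WittVector.teichmuller p (t k ^ d)))).comp
    (truncMap (s + 1) (iterateFrobenius (E k) p s)).toAddMonoidHom

theorem coeff_twist {k : Type*} [Field k] [CharP k p] (d s : ℕ) (f : W p s (E k)) (i : Fin (s + 1)) :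
    (twist k d s f).coeff i = t k ^ (d * p ^ (i : ℕ)) * f.coeff i ^ p ^ s := by
  obtain ⟨g, hg⟩ := WittVector.truncate_surjective p (s + 1) (E k)
    (truncMap (s + 1) (iterateFrobenius (E k) p s) f)
  change (WittVector.truncate (s + 1) (WittVector.teichmuller p (t k ^ d)) *
    truncMap (s + 1) (iterateFrobenius (E k) p s) f).coeff i = _
  have h := coeff_truncMap (iterateFrobenius (E k) p s) f i
  rw [← hg, ← map_mul, WittVector.coeff_truncate, coeff_teichmuller_mul, pow_mul]
  rw [← hg, WittVector.coeff_truncate, iterateFrobenius_def] at h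
  rw [h]

theorem mem_fil_iff {k : Type*} [Field k] [CharP k p] (d s : ℕ) (f : W p s (E k)) :
    (∀ i : Fin (s + 1), -(d : ℤ) ≤ (p : ℤ) ^ (s - (i : ℕ)) * (f.coeff i).order) ↔
      twist k d s f ∈ (truncMap (p := p) (s + 1) (HahnSeries.ofPowerSeries ℤ k)).range := by
  have h1 : twist k d s f ∈ (truncMap (p := p) (s + 1) (HahnSeries.ofPowerSeries ℤ k)).range ↔
      ∀ i, (twist k d s f).coeff i ∈ (HahnSeries.ofPowerSeries ℤ k).range := by
    constructor
    · rintro ⟨g, hg⟩ i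
      exact ⟨g.coeff i, by rw [← coeff_truncMap, hg]⟩
    · intro h
      choose g hg using h
      refine ⟨TruncatedWittVector.mk p g, ?_⟩
      ext1 i
      rw [coeff_truncMap, TruncatedWittVector.coeff_mk, hg]
  rw [h1]
  refine forall_congr' fun i => ?_
  rw [coeff_twist, ← order_nonneg_iff]
  have hp : 0 < p := (Fact.out : p.Prime).pos
  by_cases h0 : f.coeff i = 0
  · simp [h0, hp.ne']
  · have ht : t k ≠ 0 := by simp [t]
    have hi : s = (s - (i : ℕ)) + i := by have := i.2; omega
    rw [HahnSeries.order_mul (pow_ne_zero _ ht) (pow_ne_zero _ h0), HahnSeries.order_pow,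
      HahnSeries.order_pow]
    have hto : (t k).order = 1 := HahnSeries.order_single one_ne_zero
    rw [hto]
    have e : p ^ s = p ^ (s - (i : ℕ)) * p ^ (i : ℕ) := by rw [← pow_add, ← hi]
    have e2 : ((d * p ^ (i : ℕ)) • (1 : ℤ) + p ^ s • (f.coeff i).order : ℤ) =
        (d + (p : ℤ) ^ (s - (i : ℕ)) * (f.coeff i).order) * p ^ (i : ℕ) := by
      rw [e]; simp; ring
    rw [e2]
    have hpi : (0 : ℤ) < (p : ℤ) ^ (i : ℕ) := by positivity
    rw [mul_nonneg_iff_of_pos_right hpi]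
    constructor <;> intro h <;> linarith

/-- Kato's filtration `Fil_d W_s(E) = {f : p^{s-i} v(f_i) ≥ -d for all i}`. (The order of the zero
series is `0` here, so that a zero component imposes no condition.) -/
def FilW (p : ℕ) [Fact p.Prime] (k : Type*) [Field k] [CharP k p] (d s : ℕ) :
    AddSubgroup (W p s (E k)) where
  carrier := {f | ∀ i : Fin (s + 1), -(d : ℤ) ≤ (p : ℤ) ^ (s - (i : ℕ)) * (f.coeff i).order}
  zero_mem' := (mem_fil_iff d s 0).2 (by rw [map_zero]; exact zero_mem _)
  add_mem' {a b} ha hb := (mem_fil_iff d s (a + b)).2 (by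
    rw [map_add]; exact add_mem ((mem_fil_iff d s a).1 ha) ((mem_fil_iff d s b).1 hb))
  neg_mem' {a} ha := (mem_fil_iff d s (-a)).2 (by
    rw [map_neg]; exact neg_mem ((mem_fil_iff d s a).1 ha))

end Filtration

section Cartier

open KaehlerDifferential

/-- The absolute differentials `Ω¹_R`; in characteristic `p` these are the differentials relative
to `R^p`, as `d(x^p) = 0`. -/
abbrev Omega (R : Type*) [CommRing R] : Type _ := Ω[R⁄ℤ]

/-- The universal derivation `R → Ω¹_R`. -/
abbrev dd {R : Type*} [CommRing R] (x : R) : Omega R := D ℤ R x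

/-- The logarithmic differential `dlog x = dx / x` (equal to `0` at `x = 0`). -/
def dlog {L : Type*} [Field L] (x : L) : Omega L := x⁻¹ • dd x

/-- The map `Ω¹_R → Ω¹_S`, `a db ↦ f(a) d(f(b))`, induced by a ring homomorphism `f`. -/
def mapForms {R S : Type*} [CommRing R] [CommRing S] (f : R →+* S) : Omega R →+ Omega S :=
  letI := f.toAlgebra
  haveI : IsScalarTower ℤ R S := IsScalarTower.of_algebraMap_eq' (RingHom.ext_int _ _)
  (KaehlerDifferential.map ℤ ℤ R S).toAddMonoidHom

theorem mapForms_smul_D {R S : Type*} [CommRing R] [CommRing S] (f : R →+* S) (a b : R) :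
    mapForms f (a • dd b) = f a • dd (f b) := by
  let _ := f.toAlgebra
  have : IsScalarTower ℤ R S := IsScalarTower.of_algebraMap_eq' (RingHom.ext_int _ _)
  change KaehlerDifferential.map ℤ ℤ R S (a • dd b) = _
  rw [map_smul, KaehlerDifferential.map_D]
  rfl

section Exact

variable (k : Type*) [Field k]

/-- The subgroup `B¹Ω_k = d(k)` of exact forms. -/
def exactForms : AddSubgroup (Omega k) := (D ℤ k : k →+ Omega k).range

end Exact

theorem D_pow_p {p : ℕ} {k : Type*} [Field k] [CharP k p] (a : k) : D ℤ k (a ^ p) = 0 := by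
  rw [Derivation.leibniz_pow, ← Nat.cast_smul_eq_nsmul k]
  simp

theorem frob_smul_mem (p : ℕ) (k : Type*) [Field k] [CharP k p] (a : k) {ω : Omega k} (h : ω ∈ exactForms k) : a ^ p • ω ∈ exactForms k := by
  obtain ⟨b, rfl⟩ := h
  refine ⟨a ^ p * b, ?_⟩
  change D ℤ k (a ^ p * b) = a ^ p • D ℤ k b
  rw [Derivation.leibniz, D_pow_p, smul_zero, add_zero]

/-- `Ω¹_k / B¹Ω_k`, regarded below as a `k`-vector space with `a ∈ k` acting as multiplication
by `a^p`. -/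
def FormsModExact (_ : ℕ) (k : Type*) [Field k] : Type _ := Omega k ⧸ exactForms k

section ModExact

variable (p : ℕ) (k : Type*) [Field k]

instance : AddCommGroup (FormsModExact p k) :=
  inferInstanceAs (AddCommGroup (Omega k ⧸ exactForms k))

/-- The class of a form modulo exact forms. -/
def modExact : Omega k →+ FormsModExact p k := QuotientAddGroup.mk' (exactForms k)

theorem modExact_surjective : Function.Surjective (modExact p k) :=
  QuotientAddGroup.mk'_surjective _

theorem modExact_eq_iff (ω η : Omega k) :
    modExact p k ω = modExact p k η ↔ ω - η ∈ exactForms k := by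
  rw [← sub_eq_zero, ← map_sub]
  exact QuotientAddGroup.eq_zero_iff _

end ModExact

variable (p : ℕ) [Fact p.Prime] (k : Type*) [Field k] [CharP k p]

instance : SMul k (FormsModExact p k) where
  smul a := QuotientAddGroup.map (exactForms k) (exactForms k)
    (DistribSMul.toAddMonoidHom (Omega k) (a ^ p)) fun _ h => frob_smul_mem p k a h

theorem smul_modExact (a : k) (ω : Omega k) :
    a • modExact p k ω = modExact p k (a ^ p • ω) := rfl

instance frobModule : Module k (FormsModExact p k) where
  one_smul x := by
    obtain ⟨ω, rfl⟩ := modExact_surjective p k x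
    rw [smul_modExact, one_pow, one_smul]
  mul_smul a b x := by
    obtain ⟨ω, rfl⟩ := modExact_surjective p k x
    rw [smul_modExact, smul_modExact, smul_modExact, mul_pow, mul_smul]
  smul_zero a := by
    rw [← map_zero (modExact p k), smul_modExact, smul_zero]
  smul_add a x y := by
    obtain ⟨ω, rfl⟩ := modExact_surjective p k x
    obtain ⟨η, rfl⟩ := modExact_surjective p k y
    rw [← map_add, smul_modExact, smul_modExact, smul_modExact, smul_add, map_add]
  add_smul a b x := by
    obtain ⟨ω, rfl⟩ := modExact_surjective p k x
    rw [smul_modExact, smul_modExact, smul_modExact, add_pow_char, add_smul, map_add]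
  zero_smul x := by
    obtain ⟨ω, rfl⟩ := modExact_surjective p k x
    rw [smul_modExact, zero_pow (Fact.out : p.Prime).ne_zero, zero_smul, map_zero]

theorem exact_aux (b c : k) :
    (b + c) ^ (p - 1) • D ℤ k (b + c) - b ^ (p - 1) • D ℤ k b - c ^ (p - 1) • D ℤ k c ∈
      exactForms k := by
  let A := MvPolynomial (Fin 2) ℤ
  let x : A := MvPolynomial.X 0
  let y : A := MvPolynomial.X 1
  have hp : p.Prime := Fact.out
  obtain ⟨r, hr⟩ := exists_add_pow_prime_eq hp x y
  have key : (x + y) ^ (p - 1) • D ℤ A (x + y) - x ^ (p - 1) • D ℤ A x - y ^ (p - 1) • D ℤ A y =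
      D ℤ A (x * y * r) := by
    have hr' : (x + y) ^ p = x ^ p + y ^ p + p * (x * y * r) := by rw [hr]; ring
    have h := congrArg (D ℤ A) hr'
    rw [map_add, map_add, Derivation.leibniz_pow, Derivation.leibniz_pow, Derivation.leibniz_pow,
      Derivation.leibniz, Derivation.map_natCast, smul_zero, add_zero,
      ← Nat.cast_smul_eq_nsmul A, ← Nat.cast_smul_eq_nsmul A, ← Nat.cast_smul_eq_nsmul A] at h
    have hfree : Module.Free A (Ω[A⁄ℤ]) :=
      Module.Free.of_basis (KaehlerDifferential.mvPolynomialBasis ℤ (Fin 2))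
    have hpA : (p : A) ≠ 0 := Nat.cast_ne_zero.2 hp.ne_zero
    apply smul_right_injective (Ω[A⁄ℤ]) hpA
    change (p : A) • _ = (p : A) • _
    rw [smul_sub, smul_sub, h]
    abel
  let _ : Algebra A k := (MvPolynomial.aeval (R := ℤ) ![b, c]).toRingHom.toAlgebra
  have : IsScalarTower ℤ A k := IsScalarTower.of_algebraMap_eq' (RingHom.ext_int _ _)
  have hx : algebraMap A k x = b := by
    change MvPolynomial.aeval (R := ℤ) ![b, c] x = b
    simp [x]
  have hy : algebraMap A k y = c := by
    change MvPolynomial.aeval (R := ℤ) ![b, c] y = c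
    simp [y]
  have h := congrArg (KaehlerDifferential.map ℤ ℤ A k) key
  simp only [map_sub, map_smul, KaehlerDifferential.map_D] at h
  rw [algebra_compatible_smul k, algebra_compatible_smul k (x ^ (p - 1)),
    algebra_compatible_smul k (y ^ (p - 1)), map_pow, map_pow, map_pow, map_add, hx, hy] at h
  exact ⟨algebraMap A k (x * y * r), h.symm⟩

/-- The derivation `b ↦ [b^{p-1} db]` with values in `Ω¹_k / B¹Ω_k`. -/
def cartierDer : Derivation ℤ k (FormsModExact p k) :=
  Derivation.mk' (AddMonoidHom.toIntLinearMap (AddMonoidHom.mk'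
    (fun b => modExact p k (b ^ (p - 1) • dd b)) (fun b c => by
      rw [← map_add, modExact_eq_iff, ← sub_sub]
      exact exact_aux p k b c)))
    (fun b c => by
      change modExact p k ((b * c) ^ (p - 1) • dd (b * c)) =
        b • modExact p k (c ^ (p - 1) • dd c) + c • modExact p k (b ^ (p - 1) • dd b)
      rw [smul_modExact, smul_modExact, ← map_add]
      congr 1
      have hp : ∀ x : k, x ^ p = x ^ (p - 1) * x := fun x => by
        rw [← pow_succ, Nat.sub_add_cancel (Fact.out : p.Prime).one_le]
      rw [show dd (b * c) = b • dd c + c • dd b from Derivation.leibniz _ b c, hp b, hp c]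
      module)

/-- The inverse Cartier operator `C⁻¹ : Ω¹_k → Ω¹_k / B¹Ω_k`, `a db ↦ [a^p b^{p-1} db]`. (Its values
are classes of closed forms, so it is the usual map to `H¹(Ω_k)` followed by an inclusion.) -/
def invCartier : Omega k →+ Omega k ⧸ exactForms k :=
  (cartierDer p k).liftKaehlerDifferential.toAddMonoidHom

theorem invCartier_smul_D (a b : k) :
    invCartier p k (a • dd b) = QuotientAddGroup.mk ((a ^ p * b ^ (p - 1)) • dd b) := by
  change (cartierDer p k).liftKaehlerDifferential (a • dd b) = _
  rw [map_smul, Derivation.liftKaehlerDifferential_comp_D, mul_smul]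
  exact smul_modExact p k a _

/-- The subgroups `B_m Ω¹_k`: `B_0 = 0`, and `B_{m+1}` is the inverse image of `C⁻¹(B_m)`. -/
def BForms : ℕ → AddSubgroup (Omega k)
  | 0 => ⊥
  | m + 1 => ((BForms m).map (invCartier p k)).comap (QuotientAddGroup.mk' (exactForms k))

/-- `IsCartierIter p k m α η` says that `C^m(α)` is defined and equal to `η`, where `C` is the
Cartier operator: `C(α) = ω` if and only if `[α] = C⁻¹(ω)`. -/
def IsCartierIter : ℕ → Omega k → Omega k → Prop
  | 0, α, η => α = η
  | m + 1, α, η => ∃ ω, (QuotientAddGroup.mk α : Omega k ⧸ exactForms k) = invCartier p k ω ∧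
      IsCartierIter m ω η

theorem IsCartierIter.zero (m : ℕ) : IsCartierIter p k m 0 0 := by
  induction m with
  | zero => rfl
  | succ m ih => exact ⟨0, by rw [map_zero]; rfl, ih⟩

variable {p k} in
theorem IsCartierIter.add {m : ℕ} {α η α' η' : Omega k} (h : IsCartierIter p k m α η)
    (h' : IsCartierIter p k m α' η') : IsCartierIter p k m (α + α') (η + η') := by
  induction m generalizing α α' with
  | zero => exact congrArg₂ (· + ·) h h'
  | succ m ih =>
    obtain ⟨ω, h1, h2⟩ := h
    obtain ⟨ω', h1', h2'⟩ := h'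
    exact ⟨ω + ω', by rw [map_add, ← h1, ← h1']; rfl, ih h2 h2'⟩

variable {p k} in
theorem IsCartierIter.neg {m : ℕ} {α η : Omega k} (h : IsCartierIter p k m α η) :
    IsCartierIter p k m (-α) (-η) := by
  induction m generalizing α with
  | zero => exact congrArg _ h
  | succ m ih =>
    obtain ⟨ω, h1, h2⟩ := h
    exact ⟨-ω, by rw [map_neg, ← h1]; rfl, ih h2⟩

end Cartier

section Graded

variable (p : ℕ) [Fact p.Prime] (k : Type*) [Field k] [CharP k p]

/-- For an increasing filtration `Fil` of `A` and `d ≥ 1`, the graded piece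
`Gr_d = Fil_d / Fil_{d-1}`, as a subgroup of `A / Fil_{d-1}`. -/
def Gr {A : Type*} [AddCommGroup A] (Fil : ℕ → AddSubgroup A) (d : ℕ) :
    AddSubgroup (A ⧸ Fil (d - 1)) :=
  (Fil d).map (QuotientAddGroup.mk' (Fil (d - 1)))

/-- The class in `Gr_d` of an element of `Fil_d`. -/
def grMk {A : Type*} [AddCommGroup A] (Fil : ℕ → AddSubgroup A) (d : ℕ) (x : Fil d) : Gr Fil d :=
  ⟨QuotientAddGroup.mk' (Fil (d - 1)) x, AddSubgroup.mem_map_of_mem _ x.2⟩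

/-- The elements of an abelian group that are killed by an integer prime to `p`. -/
def primeToP (p : ℕ) (A : Type*) [AddCommGroup A] : AddSubgroup A where
  carrier := {x | ∃ N : ℕ, N.Coprime p ∧ N • x = 0}
  zero_mem' := ⟨1, Nat.coprime_one_left p, smul_zero 1⟩
  add_mem' := by
    rintro x y ⟨N, hN, hx⟩ ⟨M, hM, hy⟩
    refine ⟨N * M, hN.mul_left hM, ?_⟩
    rw [smul_add, mul_comm, mul_smul, hx, mul_comm, mul_smul, hy, smul_zero, smul_zero, add_zero]
  neg_mem' := by
    rintro x ⟨N, hN, hx⟩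
    exact ⟨N, hN, by rw [smul_neg, hx, neg_zero]⟩

/-- Kato's filtration of `H¹(G_E, ℚ_p/ℤ_p)`: the image under `δ` of
`Fil_d CW(E) = ⋃_s Fil_d W_s(E)` (an increasing union of subgroups). -/
def FilH1p (d : ℕ) : AddSubgroup (H1 (E k)) :=
  ⨆ s : ℕ, (FilW p k d s).map (delta (E k) s)

/-- Kato's filtration of `H¹(G_E, ℚ/ℤ)`: the inverse image of `Fil_d H¹(G_E, ℚ_p/ℤ_p)` under the
projection of `H¹(G_E, ℚ/ℤ)` to its `p`-primary part, whose kernel is the prime-to-`p` part. -/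
def FilH1 (d : ℕ) : AddSubgroup (H1 (E k)) := FilH1p p k d ⊔ primeToP p (H1 (E k))

theorem delta_mem_FilH1 {d s : ℕ} {f : W p s (E k)} (hf : f ∈ FilW p k d s) :
    delta (E k) s f ∈ FilH1 p k d :=
  AddSubgroup.mem_sup_left (AddSubgroup.mem_iSup_of_mem s (AddSubgroup.mem_map_of_mem _ hf))

/-- The map `F^s d : W_s(L) → Ω¹_L`, `(f_0, …, f_s) ↦ ∑ f_i^{p^{s-i}} dlog f_i`. -/
def FsD {p : ℕ} {L : Type*} [Field L] (s : ℕ) (f : W p s L) : Omega L :=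
  ∑ i : Fin (s + 1), (f.coeff i) ^ p ^ (s - (i : ℕ)) • dlog (f.coeff i)

/-- The inclusion of the constants `k ⊂ E = k((t))`. -/
abbrev const : k →+* E k := HahnSeries.C

variable {k}

/-- `Ω¹_{k[[t]]}(log) = (⨁ k[[t]] du_i) ⊕ k[[t]] dlog t` inside `Ω¹_E`, for a `p`-basis `u` of
`k`. -/
def logForms {r : ℕ} (u : Fin r → k) : Submodule (PowerSeries k) (Omega (E k)) :=
  Submodule.span (PowerSeries k) (Set.range (fun i => dd (const k (u i))) ∪ {dlog (t k)})

/-- Kato's filtration `Fil_d Ω¹_E = t^{-d} Ω¹_{k[[t]]}(log)`. -/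
def FilOmega {r : ℕ} (u : Fin r → k) (d : ℕ) : AddSubgroup (Omega (E k)) :=
  (logForms u).toAddSubgroup.map (DistribSMul.toAddMonoidHom (Omega (E k)) (t k ^ (-(d : ℤ))))

/-- The form `t^{-d} (α + β dlog t)` on `E`, for `α ∈ Ω¹_k` and `β ∈ k`. -/
def tForm (d : ℕ) (α : Omega k) (β : k) : Omega (E k) :=
  t k ^ (-(d : ℤ)) • (mapForms (const k) α + const k β • dlog (t k))

theorem tForm_add (d : ℕ) (α α' : Omega k) (β β' : k) :
    tForm d (α + α') (β + β') = tForm d α β + tForm d α' β' := by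
  simp only [tForm, map_add, add_smul, smul_add]; abel

theorem tForm_zero (d : ℕ) : tForm d (0 : Omega k) 0 = 0 := by
  simp [tForm]

theorem tForm_neg (d : ℕ) (α : Omega k) (β : k) : tForm d (-α) (-β) = -tForm d α β := by
  simp only [tForm, map_neg, neg_smul, ← smul_neg, neg_add]

/-- For `d = n p^m` with `n` prime to `p`, the subgroup `B Gr_d Ω¹_E` of `Gr_d Ω¹_E`: the classes of
`t^{-d} (α + β dlog t)` with `α ∈ B_{m+1} Ω¹_k`, `β ∈ k^{p^m}` and `n C^m(α) + d(C^m(β)) = 0`, where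
`C^m(a^{p^m}) = a`. -/
def BGr {r : ℕ} (u : Fin r → k) (n m : ℕ) : AddSubgroup (Gr (FilOmega u) (n * p ^ m)) where
  carrier := {y | ∃ (α η : Omega k) (a : k), α ∈ BForms p k (m + 1) ∧ IsCartierIter p k m α η ∧
    n • η + dd a = 0 ∧
    (y : Omega (E k) ⧸ FilOmega u (n * p ^ m - 1)) =
      QuotientAddGroup.mk (tForm (n * p ^ m) α (a ^ p ^ m))}
  zero_mem' := ⟨0, 0, 0, zero_mem _, IsCartierIter.zero p k m, by simp, by
    rw [zero_pow (pow_ne_zero _ (Fact.out : p.Prime).ne_zero), tForm_zero]; rfl⟩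
  add_mem' := by
    rintro y y' ⟨α, η, a, h1, h2, h3, h4⟩ ⟨α', η', a', h1', h2', h3', h4'⟩
    refine ⟨α + α', η + η', a + a', add_mem h1 h1', h2.add h2', ?_, ?_⟩
    · have : dd (a + a') = dd a + dd a' := map_add _ _ _
      rw [smul_add, this, add_add_add_comm, h3, h3', add_zero]
    · rw [add_pow_char_pow, tForm_add, AddSubgroup.coe_add, h4, h4']; rfl
  neg_mem' := by
    rintro y ⟨α, η, a, h1, h2, h3, h4⟩
    refine ⟨-α, -η, -a, neg_mem h1, h2.neg, ?_, ?_⟩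
    · have : dd (-a) = -dd a := map_neg _ _
      rw [smul_neg, this, ← neg_add, h3, neg_zero]
    · have : (-a) ^ p ^ m = -(a ^ p ^ m) := by
        rw [← iterateFrobenius_def, ← iterateFrobenius_def, map_neg]
      rw [this, tForm_neg, AddSubgroup.coe_neg, h4]; rfl

/-- `u_1, …, u_r` is a `p`-basis of `k`: the monomials `u^s`, `s ∈ [0, p-1]^r`, form a basis of `k`
over `k^p`. -/
def IsPBasis {r : ℕ} (u : Fin r → k) : Prop :=
  LinearIndependent (frobenius k p).fieldRange
      (fun s : Fin r → Fin p => ∏ i, u i ^ (s i : ℕ)) ∧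
    Submodule.span (frobenius k p).fieldRange
      (Set.range fun s : Fin r → Fin p => ∏ i, u i ^ (s i : ℕ)) = ⊤

/-- The `k^p`-subspace `k'` of `k` spanned by the monomials `u^s` with `s ∈ [0, p-1]^r`,
`s ≠ 0`. -/
def kPrime {r : ℕ} (u : Fin r → k) : Submodule (frobenius k p).fieldRange k :=
  Submodule.span (frobenius k p).fieldRange
    {x | ∃ s : Fin r → Fin p, (∃ i, (s i : ℕ) ≠ 0) ∧ x = ∏ i, u i ^ (s i : ℕ)}

/-- `(l_0, …, l_m) ∈ W_m(k)` is normalized: `l_j ∈ k'` for `j ≥ 1`. -/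
def IsNormalized {r : ℕ} (u : Fin r → k) {m : ℕ} (l : W p m k) : Prop :=
  ∀ j : Fin (m + 1), j ≠ 0 → l.coeff j ∈ kPrime p u

/-- The co-monomial `l · t^{-d} = (l_0 t^{-n}, l_1 t^{-np}, …, l_m t^{-np^m}) ∈ W_m(E)` of degree
`-d = -np^m`. -/
def comonomial {m : ℕ} (n : ℕ) (l : W p m k) : W p m (E k) :=
  TruncatedWittVector.mk p fun j =>
    const k (l.coeff j) * t k ^ (-((n * p ^ (j : ℕ) : ℕ) : ℤ))

variable (k) in
/-- `δ̄ : W_m(k)/pW_m(k) → Gr_d H¹(G_E, ℚ/ℤ)`, `d = np^m`, is the map that sends the class of `l` to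
the class of the character `δ(l · t^{-d})`. -/
def IsDeltaBar (n m : ℕ)
    (δbar : (W p m k ⧸ Ideal.span {(p : W p m k)}) → Gr (FilH1 p k) (n * p ^ m)) : Prop :=
  ∀ l : W p m k, (δbar (Ideal.Quotient.mk _ l) : H1 (E k) ⧸ FilH1 p k (n * p ^ m - 1)) =
    QuotientAddGroup.mk (delta (E k) m (comonomial p n l))

/-- `ψ : Gr_d H¹(G_E, ℚ/ℤ) → Gr_d Ω¹_E` satisfies `ψ ∘ gr_d(δ) = ε · gr_d(F^s d)` on
`Gr_d W_s(E)`, for all `s ≥ 0`, where `ε = ±1`. -/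
def IsRefinedSwan {r : ℕ} (u : Fin r → k) (ε : ℤˣ) (d : ℕ)
    (ψ : Gr (FilH1 p k) d →+ Gr (FilOmega u) d) : Prop :=
  ∀ (s : ℕ) (f : W p s (E k)) (hf : f ∈ FilW p k d s),
    (ψ (grMk (FilH1 p k) d ⟨delta (E k) s f, delta_mem_FilH1 p k hf⟩) :
      Omega (E k) ⧸ FilOmega u (d - 1)) = QuotientAddGroup.mk ((ε : ℤ) • FsD s f)

end Graded

end RefinedSwan

end

set_option linter.unusedSectionVars false

noncomputable section

namespace RefinedSwan

section PBasis

variable {p : ℕ} [Fact p.Prime] {k : Type*} [Field k] [CharP k p] {r : ℕ} {u : Fin r → k}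

/-- The basis of monomials attached to a `p`-basis. -/
def IsPBasis.basis (hu : IsPBasis p u) :
    Module.Basis (Fin r → Fin p) (frobenius k p).fieldRange k :=
  Module.Basis.mk hu.1 hu.2.ge

theorem IsPBasis.basis_apply (hu : IsPBasis p u) (s : Fin r → Fin p) :
    hu.basis s = ∏ i, u i ^ (s i : ℕ) := by
  simp [IsPBasis.basis]

/-- The `k^p`-linear map that multiplies the monomial `u^s` by `s_i`. -/
def IsPBasis.theta (hu : IsPBasis p u) (i : Fin r) : k →ₗ[(frobenius k p).fieldRange] k :=
  hu.basis.constr ℕ fun s => ((s i : ℕ) : (frobenius k p).fieldRange) • hu.basis s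

theorem IsPBasis.repr_theta (hu : IsPBasis p u) (i : Fin r) (x : k) (s : Fin r → Fin p) :
    hu.basis.repr (hu.theta i x) s = ((s i : ℕ) : (frobenius k p).fieldRange) *
      hu.basis.repr x s := by
  have h : (Finsupp.lapply s).comp (hu.basis.repr.toLinearMap.comp (hu.theta i)) =
      (((s i : ℕ) : (frobenius k p).fieldRange)) •
        (Finsupp.lapply s).comp hu.basis.repr.toLinearMap := by
    apply hu.basis.ext
    intro s'
    simp only [IsPBasis.theta, LinearMap.comp_apply, Module.Basis.constr_basis,
      LinearEquiv.coe_coe, map_smul, Module.Basis.repr_self, LinearMap.smul_apply]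
    by_cases hs : s' = s
    · subst hs; simp
    · simp [hs]
  exact LinearMap.congr_fun h x

theorem IsPBasis.theta_smul_pow (hu : IsPBasis p u) (i : Fin r) (c x : k) :
    hu.theta i (c ^ p * x) = c ^ p * hu.theta i x :=
  (hu.theta i).map_smul (⟨c ^ p, ⟨c, rfl⟩⟩ : (frobenius k p).fieldRange) x

theorem IsPBasis.theta_monomial (hu : IsPBasis p u) (i : Fin r) (a : Fin r → ℕ) :
    hu.theta i (∏ j, u j ^ a j) = (a i : k) * ∏ j, u j ^ a j := by
  have hp : 0 < p := (Fact.out : p.Prime).pos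
  have h : ∏ j, u j ^ a j = (∏ j, u j ^ (a j / p)) ^ p *
      hu.basis fun j => ⟨a j % p, Nat.mod_lt _ hp⟩ := by
    rw [IsPBasis.basis_apply, ← Finset.prod_pow, ← Finset.prod_mul_distrib]
    refine Finset.prod_congr rfl fun j _ => ?_
    rw [← pow_mul, ← pow_add, mul_comm, Nat.div_add_mod]
  rw [h, hu.theta_smul_pow, IsPBasis.theta, Module.Basis.constr_basis]
  have h2 : ((a i % p : ℕ) : k) = a i := by
    rw [← Nat.div_add_mod (a i) p]; simp
  rw [Subfield.smul_def, smul_eq_mul]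
  push_cast
  rw [h2]; ring

theorem IsPBasis.theta_mul (hu : IsPBasis p u) (i : Fin r) (x y : k) :
    hu.theta i (x * y) = x * hu.theta i y + y * hu.theta i x := by
  let B1 : k →ₗ[(frobenius k p).fieldRange] k →ₗ[(frobenius k p).fieldRange] k :=
    (LinearMap.mul (frobenius k p).fieldRange k).compr₂ (hu.theta i)
  let B2 := (LinearMap.mul (frobenius k p).fieldRange k).compl₂ (hu.theta i)
  have h : B1 = B2 + B2.flip := by
    apply hu.basis.ext
    intro s
    apply hu.basis.ext
    intro s'
    have e : hu.basis s * hu.basis s' = ∏ j, u j ^ ((s j : ℕ) + s' j) := by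
      simp [IsPBasis.basis_apply, pow_add, Finset.prod_mul_distrib]
    simp only [B1, B2, LinearMap.compr₂_apply, LinearMap.mul_apply', LinearMap.add_apply,
      LinearMap.compl₂_apply, LinearMap.flip_apply]
    rw [e, hu.theta_monomial, ← e, hu.basis_apply, hu.basis_apply, hu.theta_monomial,
      hu.theta_monomial]
    push_cast
    ring
  exact LinearMap.congr_fun (LinearMap.congr_fun h x) y

/-- The derivation `u_i ∂/∂u_i` of `k`. -/
def IsPBasis.der (hu : IsPBasis p u) (i : Fin r) : Derivation ℤ k k :=
  Derivation.mk' (hu.theta i).toAddMonoidHom.toIntLinearMap fun x y => hu.theta_mul i x y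

theorem IsPBasis.der_apply (hu : IsPBasis p u) (i : Fin r) (x : k) :
    hu.der i x = hu.theta i x := rfl

theorem IsPBasis.der_self (hu : IsPBasis p u) (i : Fin r) : hu.der i (u i) = u i := by
  have h := hu.theta_monomial i (Pi.single i 1)
  have e : ∏ j, u j ^ (Pi.single i 1 : Fin r → ℕ) j = u i := by
    rw [Finset.prod_eq_single i] <;> simp +contextual
  rw [e] at h
  rw [hu.der_apply, h]; simp

theorem IsPBasis.der_ne (hu : IsPBasis p u) {i j : Fin r} (hij : j ≠ i) :
    hu.der i (u j) = 0 := by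
  have h := hu.theta_monomial i (Pi.single j 1)
  have e : ∏ l, u l ^ (Pi.single j 1 : Fin r → ℕ) l = u j := by
    rw [Finset.prod_eq_single j] <;> simp +contextual
  rw [e] at h
  rw [hu.der_apply, h]; simp [hij.symm]

theorem IsPBasis.ne_zero (hu : IsPBasis p u) (i : Fin r) : u i ≠ 0 := by
  have hp := (Fact.out : p.Prime).one_lt
  let s : Fin r → Fin p := fun j => if j = i then ⟨1, hp⟩ else ⟨0, by omega⟩
  have h := hu.basis.ne_zero s
  intro h0
  apply h
  rw [hu.basis_apply]
  exact Finset.prod_eq_zero (Finset.mem_univ i) (by simp [s, h0])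

theorem fin_natCast_eq_zero {F : Type*} [Field F] [CharP F p] (a : Fin p)
    (h : ((a : ℕ) : F) = 0) : (a : ℕ) = 0 :=
  Nat.eq_zero_of_dvd_of_lt ((CharP.cast_eq_zero_iff F p _).1 h) a.2

instance charP_fieldRange : CharP (frobenius k p).fieldRange p :=
  (algebraMap (frobenius k p).fieldRange k).charP
    (algebraMap (frobenius k p).fieldRange k).injective p

theorem IsPBasis.theta_eq_zero_of_sq (hu : IsPBasis p u) (i : Fin r) {x : k}
    (h : hu.theta i (hu.theta i x) = 0) : hu.theta i x = 0 := by
  apply hu.basis.repr.injective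
  ext1 s
  rw [map_zero, Finsupp.zero_apply, hu.repr_theta]
  have h1 := congrArg (fun y => hu.basis.repr y s) h
  simp only [hu.repr_theta, map_zero, Finsupp.zero_apply] at h1
  rcases mul_eq_zero.1 h1 with h2 | h2
  · rw [h2, zero_mul]
  · exact h2

theorem IsPBasis.eq_pow_of_theta (hu : IsPBasis p u) {x : k} (h : ∀ i, hu.theta i x = 0) :
    ∃ c, c ^ p = x := by
  have hp : 0 < p := (Fact.out : p.Prime).pos
  have h1 : ∀ s : Fin r → Fin p, (∃ i, (s i : ℕ) ≠ 0) → hu.basis.repr x s = 0 := by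
    rintro s ⟨i, hi⟩
    have h2 := hu.repr_theta i x s
    rw [h i, map_zero, Finsupp.zero_apply] at h2
    rcases mul_eq_zero.1 h2.symm with h3 | h3
    · exact absurd (fin_natCast_eq_zero _ h3) hi
    · exact h3
  have h4 := hu.basis.sum_repr x
  rw [Finset.sum_eq_single (fun _ => ⟨0, hp⟩)] at h4
  · obtain ⟨c, hc⟩ := (hu.basis.repr x fun _ => ⟨0, hp⟩).2
    refine ⟨c, ?_⟩
    rw [← h4, hu.basis_apply, Subfield.smul_def, ← hc]
    simp [frobenius_def]
  · intro s _ hs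
    rw [h1 s, zero_smul]
    by_contra! h5
    exact hs (funext fun i => Fin.ext (h5 i))
  · simp

theorem IsPBasis.theta_pow (hu : IsPBasis p u) (i : Fin r) (x : k) : hu.theta i (x ^ p) = 0 := by
  rw [← hu.der_apply, Derivation.leibniz_pow, ← Nat.cast_smul_eq_nsmul k]
  simp

theorem IsPBasis.exists_pow_add (hu : IsPBasis p u) (x : k) :
    ∃ c, ∃ y ∈ kPrime p u, x = c ^ p + y := by
  have hp : 0 < p := (Fact.out : p.Prime).pos
  let s0 : Fin r → Fin p := fun _ => ⟨0, hp⟩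
  obtain ⟨c, hc⟩ := (hu.basis.repr x s0).2
  refine ⟨c, ∑ s ∈ Finset.univ.erase s0, hu.basis.repr x s • hu.basis s, ?_, ?_⟩
  · refine Submodule.sum_mem _ fun s hs => Submodule.smul_mem _ _ (Submodule.subset_span ?_)
    refine ⟨s, ?_, hu.basis_apply s⟩
    by_contra! h
    exact (Finset.mem_erase.1 hs).1 (funext fun i => Fin.ext (h i))
  · have e : c ^ p = hu.basis.repr x s0 • hu.basis s0 := by
      rw [hu.basis_apply, Subfield.smul_def, ← hc]
      simp [frobenius_def, s0]
    rw [e, Finset.add_sum_erase _ (fun s => hu.basis.repr x s • hu.basis s) (Finset.mem_univ s0),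
      hu.basis.sum_repr]

theorem IsPBasis.eq_zero_of_mem_kPrime (hu : IsPBasis p u) {c : k} (h : c ^ p ∈ kPrime p u) :
    c = 0 := by
  have hp : 0 < p := (Fact.out : p.Prime).pos
  let s0 : Fin r → Fin p := fun _ => ⟨0, hp⟩
  have h1 : ∀ y ∈ kPrime p u, hu.basis.repr y s0 = 0 := by
    intro y hy
    have : kPrime p u ≤ LinearMap.ker ((Finsupp.lapply s0).comp hu.basis.repr.toLinearMap) := by
      refine Submodule.span_le.2 ?_
      rintro _ ⟨s, ⟨i, hi⟩, rfl⟩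
      rw [← hu.basis_apply]
      have : s ≠ s0 := by rintro rfl; exact hi rfl
      simp [this]
    exact this hy
  have h2 : c ^ p = (⟨c ^ p, ⟨c, rfl⟩⟩ : (frobenius k p).fieldRange) • hu.basis s0 := by
    rw [hu.basis_apply, Subfield.smul_def]; simp [s0]
  have h3 := h1 _ h
  rw [h2, map_smul, Module.Basis.repr_self, Finsupp.smul_apply, Finsupp.single_eq_same,
    smul_eq_mul, mul_one] at h3
  have h4 : c ^ p = 0 := congrArg Subtype.val h3
  exact pow_eq_zero_iff hp.ne' |>.1 h4

/-- The linear form on `Ω¹_k` that corresponds to `u_i ∂/∂u_i`. -/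
def IsPBasis.dual (hu : IsPBasis p u) (i : Fin r) : Omega k →ₗ[k] k :=
  (hu.der i).liftKaehlerDifferential

theorem IsPBasis.dual_dd (hu : IsPBasis p u) (i : Fin r) (x : k) :
    hu.dual i (dd x) = hu.theta i x :=
  Derivation.liftKaehlerDifferential_comp_D _ _

theorem IsPBasis.dd_mem_span (hu : IsPBasis p u) (x : k) :
    dd x ∈ Submodule.span k (Set.range fun i => dd (u i)) := by
  set S := Submodule.span k (Set.range fun i => dd (u i))
  have hmul : ∀ a b : k, dd a ∈ S → dd b ∈ S → dd (a * b) ∈ S := by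
    intro a b ha hb
    rw [show dd (a * b) = a • dd b + b • dd a from Derivation.leibniz _ a b]
    exact S.add_mem (S.smul_mem _ hb) (S.smul_mem _ ha)
  have hone : dd (1 : k) ∈ S := by
    rw [show dd (1 : k) = 0 from Derivation.map_one_eq_zero _]; exact S.zero_mem
  have hpow : ∀ (a : k) (n : ℕ), dd a ∈ S → dd (a ^ n) ∈ S := by
    intro a n ha
    induction n with
    | zero => simp
    | succ n ih => rw [pow_succ]; exact hmul _ _ ih ha
  have hx : x ∈ Submodule.span (frobenius k p).fieldRange
      (Set.range fun s : Fin r → Fin p => ∏ i, u i ^ (s i : ℕ)) := by rw [hu.2]; trivial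
  induction hx using Submodule.span_induction with
  | mem y hy =>
    obtain ⟨s, rfl⟩ := hy
    refine Finset.prod_induction _ (fun y => dd y ∈ S) hmul hone fun i _ => ?_
    exact hpow _ _ (Submodule.subset_span ⟨i, rfl⟩)
  | zero => rw [show dd (0 : k) = 0 from map_zero _]; exact S.zero_mem
  | add a b _ _ ha hb =>
    rw [show dd (a + b) = dd a + dd b from map_add _ _ _]; exact S.add_mem ha hb
  | smul c a _ ha =>
    obtain ⟨_, ⟨c, rfl⟩⟩ := c
    have hc : dd (c ^ p) ∈ S := by
      rw [show dd (c ^ p) = 0 from D_pow_p c]; exact S.zero_mem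
    exact hmul _ _ hc ha

theorem IsPBasis.exists_sum (hu : IsPBasis p u) (α : Omega k) :
    ∃ a : Fin r → k, α = ∑ i, a i • dd (u i) := by
  have h : α ∈ Submodule.span k (Set.range fun i => dd (u i)) := by
    have h2 : (⊤ : Submodule k (Omega k)) ≤ Submodule.span k (Set.range fun i => dd (u i)) := by
      rw [← KaehlerDifferential.span_range_derivation ℤ k]
      refine Submodule.span_le.2 ?_
      rintro _ ⟨x, rfl⟩
      exact hu.dd_mem_span x
    exact h2 trivial
  obtain ⟨a, ha⟩ := (Submodule.mem_span_range_iff_exists_fun k).1 h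
  exact ⟨a, ha.symm⟩

theorem IsPBasis.dual_sum (hu : IsPBasis p u) (i : Fin r) (a : Fin r → k) :
    hu.dual i (∑ j, a j • dd (u j)) = a i * u i := by
  rw [map_sum, Finset.sum_eq_single i]
  · rw [map_smul, hu.dual_dd, ← hu.der_apply, hu.der_self, smul_eq_mul]
  · intro j _ hj
    rw [map_smul, hu.dual_dd, ← hu.der_apply, hu.der_ne hj, smul_zero]
  · simp

theorem IsPBasis.eq_zero_of_dual (hu : IsPBasis p u) {α : Omega k} (h : ∀ i, hu.dual i α = 0) :
    α = 0 := by
  obtain ⟨a, rfl⟩ := hu.exists_sum α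
  refine Finset.sum_eq_zero fun i _ => ?_
  have h1 := h i
  rw [hu.dual_sum] at h1
  rw [(mul_eq_zero.1 h1).resolve_right (hu.ne_zero i), zero_smul]

theorem IsPBasis.eq_pow_of_dd (hu : IsPBasis p u) {x : k} (h : dd x = 0) : ∃ c, c ^ p = x :=
  hu.eq_pow_of_theta fun i => by rw [← hu.dual_dd, h, map_zero]

theorem IsPBasis.invCartier_eq_zero (hu : IsPBasis p u) {α : Omega k}
    (h : invCartier p k α = 0) : α = 0 := by
  obtain ⟨a, rfl⟩ := hu.exists_sum α
  have h1 : invCartier p k (∑ i, a i • dd (u i)) =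
      QuotientAddGroup.mk (∑ i, (a i ^ p * u i ^ (p - 1)) • dd (u i)) := by
    rw [map_sum, ← QuotientAddGroup.mk'_apply, map_sum]
    exact Finset.sum_congr rfl fun i _ => invCartier_smul_D p k _ _
  rw [h1, QuotientAddGroup.eq_zero_iff] at h
  obtain ⟨g, hg⟩ := h
  refine Finset.sum_eq_zero fun i _ => ?_
  have h2 : hu.theta i g = (a i * u i) ^ p := by
    rw [← hu.dual_dd]
    refine (congrArg (hu.dual i) hg).trans ?_
    rw [hu.dual_sum, mul_assoc, ← pow_succ, Nat.sub_add_cancel (Fact.out : p.Prime).one_le,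
      mul_pow]
  have h3 : hu.theta i g = 0 := hu.theta_eq_zero_of_sq i (by rw [h2, hu.theta_pow])
  rw [h2] at h3
  have h4 := (pow_eq_zero_iff (Fact.out : p.Prime).ne_zero).1 h3
  rw [(mul_eq_zero.1 h4).resolve_right (hu.ne_zero i), zero_smul]

theorem IsPBasis.invCartier_injective (hu : IsPBasis p u) :
    Function.Injective (invCartier p k) :=
  (injective_iff_map_eq_zero _).2 fun _ => hu.invCartier_eq_zero

end PBasis

section WittForm

theorem mapForms_dd {R S : Type*} [CommRing R] [CommRing S] (f : R →+* S) (b : R) :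
    mapForms f (dd b) = dd (f b) := by
  have h := mapForms_smul_D f 1 b
  rwa [one_smul, map_one, one_smul] at h

/-- The form `∑ x_i^{p^{s-i}-1} dx_i`. -/
def wittForm (p : ℕ) {R : Type*} [CommRing R] (s : ℕ) (x : ℕ → R) : Omega R :=
  ∑ i ∈ Finset.range (s + 1), x i ^ (p ^ (s - i) - 1) • dd (x i)

variable {p : ℕ} [Fact p.Prime]

theorem mapForms_wittForm {R S : Type*} [CommRing R] [CommRing S] (f : R →+* S) (s : ℕ)
    (x : ℕ → R) : mapForms f (wittForm p s x) = wittForm p s fun i => f (x i) := by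
  simp only [wittForm, map_sum, mapForms_smul_D, map_pow]

theorem dd_ghostComponent {R : Type*} [CommRing R] (s : ℕ) (x : WittVector p R) :
    dd (WittVector.ghostComponent s x) = ((p ^ s : ℕ) : R) • wittForm p s x.coeff := by
  rw [WittVector.ghostComponent_apply, aeval_wittPolynomial, wittForm, Finset.smul_sum,
    show ∀ y : ℕ → R, dd (∑ i ∈ Finset.range (s + 1), y i) = ∑ i ∈ Finset.range (s + 1), dd (y i)
      from fun y => map_sum (KaehlerDifferential.D ℤ R) _ _]
  refine Finset.sum_congr rfl fun i hi => ?_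
  have hi' : i ≤ s := Nat.lt_succ_iff.1 (Finset.mem_range.1 hi)
  unfold dd
  rw [Derivation.leibniz, Derivation.leibniz_pow, ← Nat.cast_pow, Derivation.map_natCast,
    smul_zero, add_zero, ← Nat.cast_smul_eq_nsmul R, smul_smul, ← Nat.cast_mul, ← pow_add,
    Nat.add_sub_cancel' hi']

theorem wittForm_add_of_injective {A : Type*} [CommRing A] (s : ℕ) (X Y : WittVector p A)
    (h : Function.Injective fun ω : Omega A => ((p ^ s : ℕ) : A) • ω) :
    wittForm p s (X + Y).coeff = wittForm p s X.coeff + wittForm p s Y.coeff := by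
  apply h
  simp only
  rw [smul_add, ← dd_ghostComponent, ← dd_ghostComponent, ← dd_ghostComponent, map_add]
  exact map_add _ _ _

theorem wittForm_add {R : Type*} [CommRing R] (s : ℕ) (x y : WittVector p R) :
    wittForm p s (x + y).coeff = wittForm p s x.coeff + wittForm p s y.coeff := by
  let X : WittVector p (MvPolynomial (Fin 2 × ℕ) ℤ) :=
    WittVector.mk p fun i => MvPolynomial.X (0, i)
  let Y : WittVector p (MvPolynomial (Fin 2 × ℕ) ℤ) :=
    WittVector.mk p fun i => MvPolynomial.X (1, i)
  have key : wittForm p s (X + Y).coeff = wittForm p s X.coeff + wittForm p s Y.coeff := by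
    have hfree : Module.Free (MvPolynomial (Fin 2 × ℕ) ℤ) (Ω[MvPolynomial (Fin 2 × ℕ) ℤ⁄ℤ]) :=
      Module.Free.of_basis (KaehlerDifferential.mvPolynomialBasis ℤ _)
    have hpA : ((p ^ s : ℕ) : MvPolynomial (Fin 2 × ℕ) ℤ) ≠ 0 :=
      Nat.cast_ne_zero.2 (pow_ne_zero _ (Fact.out : p.Prime).ne_zero)
    exact wittForm_add_of_injective s X Y
      (smul_right_injective (Ω[MvPolynomial (Fin 2 × ℕ) ℤ⁄ℤ]) hpA)
  let φ : MvPolynomial (Fin 2 × ℕ) ℤ →+* R := MvPolynomial.eval₂Hom (Int.castRingHom R)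
    fun a => if a.1 = 0 then x.coeff a.2 else y.coeff a.2
  have hX : WittVector.map φ X = x := by
    ext i
    rw [WittVector.map_coeff]
    exact (MvPolynomial.eval₂Hom_X' _ _ _).trans (if_pos rfl)
  have hY : WittVector.map φ Y = y := by
    ext i
    rw [WittVector.map_coeff]
    exact (MvPolynomial.eval₂Hom_X' _ _ _).trans (if_neg (by simp))
  have h := congrArg (mapForms φ) key
  rw [map_add, mapForms_wittForm, mapForms_wittForm, mapForms_wittForm] at h
  simp only [← WittVector.map_coeff, map_add, hX, hY] at h
  exact h

theorem wittForm_congr {R : Type*} [CommRing R] {s : ℕ} {x y : ℕ → R}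
    (h : ∀ i ≤ s, x i = y i) : wittForm p s x = wittForm p s y :=
  Finset.sum_congr rfl fun i hi => by
    rw [h i (Nat.lt_succ_iff.1 (Finset.mem_range.1 hi))]

theorem wittForm_verschiebung {R : Type*} [CommRing R] (s : ℕ) (x : WittVector p R) :
    wittForm p (s + 1) (WittVector.verschiebung x).coeff = wittForm p s x.coeff := by
  rw [wittForm, Finset.sum_range_succ']
  rw [WittVector.verschiebung_coeff_zero, show dd (0 : R) = 0 from map_zero _, smul_zero, add_zero]
  refine Finset.sum_congr rfl fun i _ => ?_
  rw [WittVector.verschiebung_coeff_succ, Nat.add_sub_add_right]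

theorem wittForm_last {R : Type*} [CommRing R] (s : ℕ) (x : ℕ → R) :
    wittForm p (s + 1) x =
      ∑ i ∈ Finset.range (s + 1), x i ^ (p ^ (s + 1 - i) - 1) • dd (x i) + dd (x (s + 1)) := by
  rw [wittForm, Finset.sum_range_succ]
  simp

variable {k : Type*} [Field k] [CharP k p]

theorem wittForm_pow (s : ℕ) (x : ℕ → k) : wittForm p s (fun i => x i ^ p) = 0 :=
  Finset.sum_eq_zero fun i _ => by
    rw [show dd (x i ^ p) = 0 from D_pow_p (x i), smul_zero]

theorem smul_dlog {L : Type*} [Field L] (x : L) {q : ℕ} (hq : 0 < q) :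
    x ^ q • dlog x = x ^ (q - 1) • dd x := by
  by_cases h : x = 0
  · subst h
    rw [dlog, show dd (0 : L) = 0 from map_zero _, smul_zero, smul_zero, smul_zero]
  · rw [dlog, smul_smul]
    congr 1
    obtain ⟨q, rfl⟩ : ∃ q', q = q' + 1 := ⟨q - 1, by omega⟩
    rw [pow_succ, mul_assoc, mul_inv_cancel₀ h, mul_one, Nat.add_sub_cancel]

theorem sum_smul_dlog {L : Type*} [Field L] (s : ℕ) (x : ℕ → L) :
    ∑ i : Fin (s + 1), x i ^ p ^ (s - (i : ℕ)) • dlog (x i) = wittForm p s x := by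
  rw [wittForm, Finset.sum_range]
  exact Finset.sum_congr rfl fun i _ => smul_dlog _ (pow_pos (Fact.out : p.Prime).pos _)

theorem FsD_truncate {L : Type*} [Field L] (s : ℕ) (x : WittVector p L) :
    FsD s (WittVector.truncate (s + 1) x) = wittForm p s x.coeff := by
  rw [← sum_smul_dlog]
  simp [FsD]

theorem invCartier_wittForm (s : ℕ) (x : ℕ → k) :
    invCartier p k (wittForm p s x) = QuotientAddGroup.mk (wittForm p (s + 1) x) := by
  have h1 : invCartier p k (wittForm p s x) = QuotientAddGroup.mk
      (∑ i ∈ Finset.range (s + 1), x i ^ (p ^ (s + 1 - i) - 1) • dd (x i)) := by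
    rw [wittForm, map_sum, ← QuotientAddGroup.mk'_apply, map_sum]
    refine Finset.sum_congr rfl fun i hi => ?_
    rw [invCartier_smul_D, QuotientAddGroup.mk'_apply, ← pow_mul, ← pow_add]
    have hi' : i ≤ s := Nat.lt_succ_iff.1 (Finset.mem_range.1 hi)
    have hp := (Fact.out : p.Prime).pos
    congr 3
    rw [Nat.succ_sub hi', pow_succ, Nat.sub_one_mul]
    have : p ≤ p ^ (s - i) * p := Nat.le_mul_of_pos_left _ (pow_pos hp _)
    omega
  rw [h1, wittForm_last, QuotientAddGroup.mk_add]
  have h2 : (QuotientAddGroup.mk (dd (x (s + 1))) : Omega k ⧸ exactForms k) = 0 :=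
    (QuotientAddGroup.eq_zero_iff _).2 ⟨_, rfl⟩
  rw [h2, add_zero]

theorem isCartierIter_wittForm (m : ℕ) (x : ℕ → k) :
    IsCartierIter p k m (wittForm p m x) (dd (x 0)) := by
  induction m with
  | zero => simp [IsCartierIter, wittForm]
  | succ m ih => exact ⟨_, (invCartier_wittForm m x).symm, ih⟩

theorem wittForm_mem_BForms (m : ℕ) (x : ℕ → k) : wittForm p m x ∈ BForms p k (m + 1) := by
  induction m with
  | zero =>
    refine ⟨0, zero_mem _, ?_⟩
    rw [map_zero]
    refine ((QuotientAddGroup.eq_zero_iff _).2 ?_).symm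
    exact ⟨x 0, by simp [wittForm]⟩
  | succ m ih => exact ⟨_, ih, invCartier_wittForm m x⟩

theorem exists_wittForm_of_isCartierIter {m : ℕ} {α : Omega k} {a : k}
    (h : IsCartierIter p k m α (dd a)) : ∃ x : ℕ → k, x 0 = a ∧ α = wittForm p m x := by
  induction m generalizing α with
  | zero =>
    refine ⟨fun _ => a, rfl, ?_⟩
    simpa [wittForm] using (show α = dd a from h)
  | succ m ih =>
    obtain ⟨ω, h1, h2⟩ := h
    obtain ⟨x, hx, rfl⟩ := ih h2
    let x' := Function.update x (m + 1) 0
    have e : wittForm p m x = wittForm p m x' :=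
      wittForm_congr fun i hi => by simp [x', Function.update_of_ne (show i ≠ m + 1 by omega)]
    rw [e, invCartier_wittForm, eq_comm, QuotientAddGroup.eq] at h1
    obtain ⟨y, hy⟩ := h1
    refine ⟨Function.update x (m + 1) y, ?_, ?_⟩
    · rw [Function.update_of_ne (by omega), hx]
    · rw [wittForm_last] at hy ⊢
      have h3 : dd y = -(wittForm p (m + 1) x') + α := by rw [wittForm_last]; exact hy
      rw [Function.update_self, h3, wittForm_last]
      have h4 : ∀ z, ∑ i ∈ Finset.range (m + 1), Function.update x (m + 1) z i ^
          (p ^ (m + 1 - i) - 1) • dd (Function.update x (m + 1) z i) =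
          ∑ i ∈ Finset.range (m + 1), x i ^ (p ^ (m + 1 - i) - 1) • dd (x i) := fun z =>
        Finset.sum_congr rfl fun i hi => by
          rw [Function.update_of_ne (Finset.mem_range.1 hi).ne]
      rw [h4]
      simp only [x']
      rw [h4, Function.update_self, show dd (0 : k) = 0 from map_zero _]
      abel

variable {r : ℕ} {u : Fin r → k}

theorem IsPBasis.eq_pow_of_wittForm (hu : IsPBasis p u) {s : ℕ} {x : ℕ → k}
    (h : wittForm p s x = 0) : ∀ i ≤ s, ∃ c, c ^ p = x i := by
  induction s with
  | zero =>
    intro i hi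
    obtain rfl : i = 0 := by omega
    exact hu.eq_pow_of_dd (by simpa [wittForm] using h)
  | succ s ih =>
    have h1 := ih (hu.invCartier_eq_zero (by rw [invCartier_wittForm, h]; rfl))
    intro i hi
    rcases Nat.lt_or_eq_of_le hi with hi | rfl
    · exact h1 i (by omega)
    · rw [wittForm_last, Finset.sum_eq_zero, zero_add] at h
      · exact hu.eq_pow_of_dd h
      · intro i hi
        obtain ⟨c, hc⟩ := h1 i (Nat.lt_succ_iff.1 (Finset.mem_range.1 hi))
        rw [← hc, show dd (c ^ p) = 0 from D_pow_p c, smul_zero]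

theorem IsPBasis.eq_of_wittForm_eq (hu : IsPBasis p u) {s : ℕ} {x y : ℕ → k}
    (hx : ∀ i ≤ s, i ≠ 0 → x i ∈ kPrime p u) (hy : ∀ i ≤ s, i ≠ 0 → y i ∈ kPrime p u)
    (h0 : x 0 = y 0) (h : wittForm p s x = wittForm p s y) : ∀ i ≤ s, x i = y i := by
  induction s with
  | zero =>
    intro i hi
    obtain rfl : i = 0 := by omega
    exact h0
  | succ s ih =>
    have h1 := ih (fun i hi => hx i (by omega)) (fun i hi => hy i (by omega))
      (hu.invCartier_injective (by rw [invCartier_wittForm, invCartier_wittForm, h]))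
    intro i hi
    rcases Nat.lt_or_eq_of_le hi with hi | rfl
    · exact h1 i (by omega)
    · rw [wittForm_last, wittForm_last, Finset.sum_congr rfl fun i hi => by
        rw [h1 i (Nat.lt_succ_iff.1 (Finset.mem_range.1 hi))], add_right_inj] at h
      obtain ⟨c, hc⟩ := hu.eq_pow_of_dd (x := x (s + 1) - y (s + 1)) (by
        rw [show dd (x (s + 1) - y (s + 1)) = dd (x (s + 1)) - dd (y (s + 1)) from
          map_sub _ _ _, h, sub_self])
      have h2 := Submodule.sub_mem _ (hx _ hi (by omega)) (hy _ hi (by omega))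
      rw [← hc] at h2
      rw [hu.eq_zero_of_mem_kPrime h2, zero_pow (Fact.out : p.Prime).ne_zero] at hc
      exact (sub_eq_zero.1 hc.symm)

theorem IsPBasis.exists_normalized (hu : IsPBasis p u) (s : ℕ) (x : ℕ → k) :
    ∃ y : ℕ → k, (∀ i, i ≠ 0 → y i ∈ kPrime p u) ∧ y 0 = x 0 ∧
      wittForm p s y = wittForm p s x := by
  induction s with
  | zero =>
    refine ⟨fun i => if i = 0 then x 0 else 0, ?_, rfl, by simp [wittForm]⟩
    intro i hi
    simp only [if_neg hi]
    exact Submodule.zero_mem _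
  | succ s ih =>
    obtain ⟨y, hy, h0, h⟩ := ih
    have h1 := congrArg (invCartier p k) h
    rw [invCartier_wittForm, invCartier_wittForm, QuotientAddGroup.eq] at h1
    obtain ⟨z, hz⟩ := h1
    obtain ⟨c, w, hw, e⟩ := hu.exists_pow_add (z + y (s + 1))
    refine ⟨Function.update y (s + 1) w, ?_, ?_, ?_⟩
    · intro i hi
      by_cases hs : i = s + 1
      · subst hs; rwa [Function.update_self]
      · rw [Function.update_of_ne hs]; exact hy i hi
    · rw [Function.update_of_ne (by omega), h0]
    · have h3 : dd z = -wittForm p (s + 1) y + wittForm p (s + 1) x := hz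
      have h4 : dd w = dd z + dd (y (s + 1)) := by
        have := congrArg dd e
        rw [show dd (z + y (s + 1)) = dd z + dd (y (s + 1)) from map_add _ _ _,
          show dd (c ^ p + w) = dd (c ^ p) + dd w from map_add _ _ _,
          show dd (c ^ p) = 0 from D_pow_p c, zero_add] at this
        exact this.symm
      rw [wittForm_last, Function.update_self, h4, h3, wittForm_last s y,
        Finset.sum_congr rfl fun i hi => by
          rw [Function.update_of_ne (Finset.mem_range.1 hi).ne]]
      abel

end WittForm

section Verschiebung

variable {p : ℕ} [Fact p.Prime]

/-- The Verschiebung `(x_0, …, x_{n-1}) ↦ (0, x_0, …, x_{n-1})` of truncated Witt vectors. -/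
def truncV {R : Type*} [CommRing R] (n : ℕ) :
    TruncatedWittVector p n R →+ TruncatedWittVector p (n + 1) R :=
  AddMonoidHom.mk' (fun x => TruncatedWittVector.mk p fun i => Fin.cases 0 (fun j => x.coeff j) i)
    (by
      have h : ∀ z : WittVector p R, (TruncatedWittVector.mk p fun i =>
          (Fin.cases 0 (fun j => (WittVector.truncate n z).coeff j) i : R)) =
          WittVector.truncate (n + 1) (WittVector.verschiebung z) := by
        intro z
        ext i
        refine Fin.cases ?_ (fun j => ?_) i
        · simp
        · simp [WittVector.verschiebung_coeff_succ]
      intro x y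
      obtain ⟨x, rfl⟩ := WittVector.truncate_surjective p n R x
      obtain ⟨y, rfl⟩ := WittVector.truncate_surjective p n R y
      rw [← map_add, h, h, h, map_add, map_add])

theorem coeff_truncV_zero {R : Type*} [CommRing R] {n : ℕ} (x : TruncatedWittVector p n R) :
    (truncV n x).coeff 0 = 0 := rfl

theorem coeff_truncV_succ {R : Type*} [CommRing R] {n : ℕ} (x : TruncatedWittVector p n R)
    (i : Fin n) : (truncV n x).coeff i.succ = x.coeff i := rfl

theorem truncV_truncate {R : Type*} [CommRing R] {n : ℕ} (x : WittVector p R) :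
    truncV n (WittVector.truncate n x) =
      WittVector.truncate (n + 1) (WittVector.verschiebung x) := by
  ext i
  refine Fin.cases ?_ (fun j => ?_) i
  · simp [coeff_truncV_zero]
  · simp [coeff_truncV_succ, WittVector.verschiebung_coeff_succ]

theorem truncV_truncMap {R S : Type*} [CommRing R] [CommRing S] {n : ℕ} (f : R →+* S)
    (x : TruncatedWittVector p n R) :
    truncV n (truncMap n f x) = truncMap (n + 1) f (truncV n x) := by
  ext i
  refine Fin.cases ?_ (fun j => ?_) i
  · simp [coeff_truncV_zero, coeff_truncMap]
  · simp [coeff_truncV_succ, coeff_truncMap]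

theorem truncMap_injective {R S : Type*} [CommRing R] [CommRing S] {n : ℕ} {f : R →+* S}
    (hf : Function.Injective f) : Function.Injective (truncMap (p := p) n f) := by
  intro x y h
  ext i
  exact hf (congrArg (TruncatedWittVector.coeff i) h)

theorem truncV_ofZMod {R : Type*} [CommRing R] [CharP R p] {n : ℕ} (a : ℕ) :
    truncV n (ofZMod R n (a : ZMod (p ^ n))) = ofZMod R (n + 1) ((a * p : ℕ) : ZMod (p ^ (n + 1))) := by
  have h1 : truncV n (1 : TruncatedWittVector p n R) = (p : TruncatedWittVector p (n + 1) R) := by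
    rw [← map_one (WittVector.truncate n), truncV_truncate, ← map_one WittVector.frobenius,
      WittVector.verschiebung_frobenius, one_mul, map_natCast]
  rw [map_natCast (ofZMod R n), map_natCast (ofZMod R (n + 1)), ← nsmul_one a, map_nsmul, h1, nsmul_eq_mul]
  push_cast
  rfl

/-- Multiplication by `p` is `F ∘ V`. -/
theorem natCast_mul_truncate {R : Type*} [CommRing R] [CharP R p] {n : ℕ} (x : WittVector p R) :
    (p : TruncatedWittVector p n R) * WittVector.truncate n x =
      truncMap n (frobenius R p) (WittVector.truncate n (WittVector.verschiebung x)) := by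
  rw [truncMap_truncate, ← WittVector.frobenius_eq_map_frobenius,
    WittVector.frobenius_verschiebung, map_mul, map_natCast, mul_comm]

end Verschiebung

theorem zmodToQmodZ_natCast (N : ℕ) [NeZero N] (a : ℕ) :
    zmodToQmodZ N (a : ZMod N) = QuotientAddGroup.mk ((a : ℚ) * (N : ℚ)⁻¹) := by
  have h : zmodToQmodZ N ((a : ℤ) : ZMod N) = _ := ZMod.lift_coe N _ (a : ℤ)
  rw [← Int.cast_natCast, h]
  simp

theorem zmodToQmodZ_injective (N : ℕ) [NeZero N] : Function.Injective (zmodToQmodZ N) := by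
  rw [injective_iff_map_eq_zero]
  intro j hj
  rw [← ZMod.natCast_zmod_val j, zmodToQmodZ_natCast, QuotientAddGroup.eq_zero_iff] at hj
  obtain ⟨z, hz⟩ := hj
  have hN : (N : ℚ) ≠ 0 := Nat.cast_ne_zero.2 (NeZero.ne N)
  have h1 : ((j.val : ℤ) : ℚ) = ((z * N : ℤ) : ℚ) := by
    have hz' : (z : ℚ) = j.val * (N : ℚ)⁻¹ := hz
    push_cast
    rw [hz']
    field_simp
  have h2 : (j.val : ℤ) = z * N := Int.cast_injective h1
  have h3 : N ∣ j.val := Int.natCast_dvd_natCast.1 ⟨z, by rw [h2, mul_comm]⟩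
  rw [← ZMod.natCast_zmod_val j]
  exact (ZMod.natCast_eq_zero_iff _ _).2 h3

section Delta

variable {p : ℕ} [Fact p.Prime] {K : Type*} [Field K] [CharP K p]

theorem delta_apply (s : ℕ) (f : W p s K) (γ : Additive Gal(SeparableClosure K/K)) :
    (delta K s f : Additive Gal(SeparableClosure K/K) →+ QmodZ) γ =
      zmodToQmodZ (p ^ (s + 1)) (aswPeriod K f γ.toMul) := rfl

theorem IsASWRoot.truncV {n : ℕ} {f : TruncatedWittVector p n K}
    {ν : TruncatedWittVector p n (SeparableClosure K)} (h : IsASWRoot K f ν) :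
    IsASWRoot K (truncV n f) (truncV n ν) := by
  unfold IsASWRoot at *
  rw [← truncV_truncMap, ← truncV_truncMap, ← h, map_sub]

theorem aswPeriod_truncV {n : ℕ} (f : TruncatedWittVector p n K)
    (γ : Gal(SeparableClosure K/K)) :
    aswPeriod K (truncV n f) γ = (((aswPeriod K f γ).val * p : ℕ) : ZMod (p ^ (n + 1))) := by
  obtain ⟨ν, h⟩ := exists_isASWRoot K f
  apply ofZMod_injective (R := SeparableClosure K)
  rw [ofZMod_aswPeriod h.truncV, ← truncV_ofZMod, ZMod.natCast_zmod_val, ofZMod_aswPeriod h,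
    map_sub, ← truncV_truncMap]

theorem delta_truncV (s : ℕ) (f : W p s K) :
    delta K (s + 1) (truncV (s + 1) f) = delta K s f := by
  refine Subtype.ext (AddMonoidHom.ext fun γ => ?_)
  rw [delta_apply, delta_apply, aswPeriod_truncV, zmodToQmodZ_natCast]
  conv_rhs => rw [← ZMod.natCast_zmod_val (aswPeriod K f γ.toMul), zmodToQmodZ_natCast]
  congr 1
  have hp : (p : ℚ) ≠ 0 := Nat.cast_ne_zero.2 (Fact.out : p.Prime).ne_zero
  push_cast
  field_simp
  ring

theorem delta_wp (s : ℕ) (h : W p s K) :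
    delta K s (truncMap (s + 1) (frobenius K p) h - h) = 0 := by
  have hroot : IsASWRoot K (truncMap (s + 1) (frobenius K p) h - h)
      (truncMap (s + 1) (algebraMap K (SeparableClosure K)) h) := by
    unfold IsASWRoot
    rw [map_sub]
    congr 1
    ext i
    simp [coeff_truncMap, frobenius_def]
  refine Subtype.ext (AddMonoidHom.ext fun γ => ?_)
  rw [delta_apply]
  have h1 : aswPeriod K (truncMap (s + 1) (frobenius K p) h - h) γ.toMul = 0 := by
    apply ofZMod_injective (R := SeparableClosure K)
    rw [ofZMod_aswPeriod hroot, map_zero, sub_eq_zero]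
    ext i
    simp [coeff_truncMap]
  rw [h1, map_zero]
  rfl

theorem delta_frobenius (s : ℕ) (f : W p s K) :
    delta K s (truncMap (s + 1) (frobenius K p) f) = delta K s f := by
  rw [← sub_eq_zero, ← map_sub, delta_wp]

theorem exists_of_delta_eq_zero (s : ℕ) {f : W p s K} (hf : delta K s f = 0) :
    ∃ h : W p s K, f = truncMap (s + 1) (frobenius K p) h - h := by
  obtain ⟨ν, hν⟩ := exists_isASWRoot K f
  have h1 : ∀ γ : Gal(SeparableClosure K/K), galW K (s + 1) γ ν = ν := by
    intro γ
    have h2 : zmodToQmodZ (p ^ (s + 1)) (aswPeriod K f γ) = 0 := by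
      have := delta_apply s f (Additive.ofMul γ)
      rw [hf] at this
      exact this.symm
    rw [← map_zero (zmodToQmodZ (p ^ (s + 1)))] at h2
    have h3 := ofZMod_aswPeriod hν γ
    rw [zmodToQmodZ_injective _ h2, map_zero] at h3
    exact sub_eq_zero.1 h3.symm
  have h4 : ∀ i, ∃ a, algebraMap K (SeparableClosure K) a = ν.coeff i := by
    intro i
    have h5 := (InfiniteGalois.mem_range_algebraMap_iff_fixed (k := K) (K := SeparableClosure K)
      (ν.coeff i)).2 fun γ => congrArg (TruncatedWittVector.coeff i) (h1 γ)
    exact h5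
  choose a ha using h4
  refine ⟨TruncatedWittVector.mk p a, ?_⟩
  have h6 : truncMap (s + 1) (algebraMap K (SeparableClosure K)) (TruncatedWittVector.mk p a) =
      ν := by
    ext i
    rw [coeff_truncMap, TruncatedWittVector.coeff_mk, ha]
  apply truncMap_injective (algebraMap K (SeparableClosure K)).injective
  rw [map_sub, h6, ← hν]
  congr 1
  rw [← h6]
  ext i
  simp [coeff_truncMap, frobenius_def]

theorem FsD_truncV (s : ℕ) (f : W p s K) : FsD (s + 1) (truncV (s + 1) f) = FsD s f := by
  obtain ⟨f, rfl⟩ := WittVector.truncate_surjective p (s + 1) K f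
  rw [truncV_truncate, FsD_truncate, FsD_truncate, wittForm_verschiebung]

theorem FsD_add (s : ℕ) (f g : W p s K) : FsD s (f + g) = FsD s f + FsD s g := by
  obtain ⟨f, rfl⟩ := WittVector.truncate_surjective p (s + 1) K f
  obtain ⟨g, rfl⟩ := WittVector.truncate_surjective p (s + 1) K g
  rw [← map_add, FsD_truncate, FsD_truncate, FsD_truncate, wittForm_add]

theorem FsD_sub (s : ℕ) (f g : W p s K) : FsD s (f - g) = FsD s f - FsD s g := by
  rw [eq_sub_iff_add_eq, ← FsD_add, sub_add_cancel]

theorem FsD_frobenius (s : ℕ) (f : W p s K) :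
    FsD s (truncMap (s + 1) (frobenius K p) f) = 0 := by
  obtain ⟨f, rfl⟩ := WittVector.truncate_surjective p (s + 1) K f
  rw [truncMap_truncate, FsD_truncate, ← wittForm_pow s f.coeff]
  rfl

end Delta

section FilW

variable {p : ℕ} [Fact p.Prime] {k : Type*} [Field k] [CharP k p]

theorem FilW_mono {d d' s : ℕ} (h : d ≤ d') : FilW p k d s ≤ FilW p k d' s :=
  fun f hf i => by have := hf i; omega

theorem truncV_mem_FilW {d s : ℕ} {f : W p s (E k)} (hf : f ∈ FilW p k d s) :
    truncV (s + 1) f ∈ FilW p k d (s + 1) := by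
  intro i
  refine Fin.cases ?_ (fun j => ?_) i
  · rw [coeff_truncV_zero, HahnSeries.order_zero]; simp
  · rw [coeff_truncV_succ, Fin.val_succ, Nat.add_sub_add_right]
    exact hf j

theorem exists_mem_FilW {s : ℕ} (f : W p s (E k)) : ∃ d, f ∈ FilW p k d s := by
  refine ⟨∑ i : Fin (s + 1), ((p : ℤ) ^ (s - (i : ℕ)) * (f.coeff i).order).natAbs, fun i => ?_⟩
  have := Finset.single_le_sum (f := fun i : Fin (s + 1) =>
    ((p : ℤ) ^ (s - (i : ℕ)) * (f.coeff i).order).natAbs) (fun _ _ => Nat.zero_le _)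
    (Finset.mem_univ i)
  omega

theorem mem_FilW_of_wp_mem {d s : ℕ} {h : W p s (E k)}
    (hh : truncMap (s + 1) (frobenius (E k) p) h - h ∈ FilW p k d s) :
    h ∈ FilW p k (d / p) s := by
  classical
  have hp : 2 ≤ p := (Fact.out : p.Prime).two_le
  let D := Nat.find (exists_mem_FilW h)
  have hD : h ∈ FilW p k D s := Nat.find_spec (exists_mem_FilW h)
  by_cases hle : D ≤ d / p
  · exact FilW_mono hle hD
  exfalso
  have h1 : d < p * D := by
    rw [mul_comm]
    exact (Nat.div_lt_iff_lt_mul (by omega)).1 (not_le.1 hle)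
  have hD1 : 1 ≤ D := lt_of_le_of_lt (Nat.zero_le _) (not_le.1 hle)
  have h2 : D ≤ p * D - 1 := by
    have : 2 * D ≤ p * D := Nat.mul_le_mul_right _ hp
    omega
  have h3 : truncMap (s + 1) (frobenius (E k) p) h ∈ FilW p k (p * D - 1) s := by
    have := add_mem (FilW_mono (show d ≤ p * D - 1 by omega) hh) (FilW_mono h2 hD)
    rwa [sub_add_cancel] at this
  refine Nat.find_min (exists_mem_FilW h) (m := D - 1) (by omega) fun i => ?_
  have h4 := h3 i
  rw [coeff_truncMap, frobenius_def, HahnSeries.order_pow, nsmul_eq_mul, mul_left_comm] at h4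
  set o := (p : ℤ) ^ (s - (i : ℕ)) * (h.coeff i).order
  have h5 : ((p * D - 1 : ℕ) : ℤ) = p * D - 1 := by
    rw [Nat.cast_sub (by omega)]; push_cast; rfl
  have h6 : ((D - 1 : ℕ) : ℤ) = D - 1 := by rw [Nat.cast_sub hD1]; rfl
  rw [h5] at h4
  change -((D - 1 : ℕ) : ℤ) ≤ o
  rw [h6]
  have h7 : 0 < (p : ℤ) * (D + o) := by linarith
  have h8 := pos_of_mul_pos_right h7 (Int.natCast_nonneg p)
  linarith

theorem t_ne_zero : t k ≠ 0 := by simp [t]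

theorem order_t : (t k).order = 1 := HahnSeries.order_single one_ne_zero

theorem order_twist {x : E k} (hx : x ≠ 0) (d s i : ℕ) (hi : i ≤ s) :
    (t k ^ (d * p ^ i) * x ^ p ^ s).order = (p : ℤ) ^ i * (d + (p : ℤ) ^ (s - i) * x.order) := by
  rw [HahnSeries.order_mul (pow_ne_zero _ t_ne_zero) (pow_ne_zero _ hx), HahnSeries.order_pow,
    HahnSeries.order_pow, order_t]
  have e : p ^ s = p ^ (s - i) * p ^ i := by rw [← pow_add, Nat.sub_add_cancel hi]
  rw [e]; simp; ring

theorem constantCoeff_eq_coeff (g : PowerSeries k) :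
    PowerSeries.constantCoeff g = (HahnSeries.ofPowerSeries ℤ k g).coeff 0 := by
  have h := LaurentSeries.coeff_coe_powerSeries g 0
  simp only [Nat.cast_zero] at h
  rw [h, PowerSeries.coeff_zero_eq_constantCoeff]

theorem coeff_of_neg (g : PowerSeries k) {i : ℤ} (hi : i < 0) :
    (HahnSeries.ofPowerSeries ℤ k g).coeff i = 0 := by
  rw [HahnSeries.ofPowerSeries_apply]
  apply HahnSeries.embDomain_of_notMem_range
  rintro ⟨a, ha⟩
  have ha' : (a : ℤ) = i := ha
  omega

/-- Elements of `Fil_d W_s(E)` whose components agree modulo smaller poles differ by an element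
of `Fil_{d-1} W_s(E)`. -/
theorem sub_mem_FilW {d s : ℕ} (hd : 0 < d) {a b : W p s (E k)} (ha : a ∈ FilW p k d s)
    (hb : b ∈ FilW p k d s)
    (h : ∀ i : Fin (s + 1), -(d : ℤ) < (p : ℤ) ^ (s - (i : ℕ)) * (a.coeff i - b.coeff i).order) :
    a - b ∈ FilW p k (d - 1) s := by
  have hp : (0 : ℤ) < p := by exact_mod_cast (Fact.out : p.Prime).pos
  obtain ⟨X, hX⟩ := (mem_fil_iff d s a).1 ha
  obtain ⟨Y, hY⟩ := (mem_fil_iff d s b).1 hb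
  have e : ∀ (Z : W p s (PowerSeries k)) (c : W p s (E k)),
      truncMap (s + 1) (HahnSeries.ofPowerSeries ℤ k) Z = twist k d s c → ∀ i,
      HahnSeries.ofPowerSeries ℤ k (Z.coeff i) =
        t k ^ (d * p ^ (i : ℕ)) * c.coeff i ^ p ^ s := by
    intro Z c hZ i
    rw [← coeff_twist, ← hZ, coeff_truncMap]
  have h1 : truncMap (s + 1) PowerSeries.constantCoeff (X - Y) = 0 := by
    rw [map_sub, sub_eq_zero]
    ext i
    rw [coeff_truncMap, coeff_truncMap, ← sub_eq_zero, ← map_sub, constantCoeff_eq_coeff, map_sub,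
      e X a hX, e Y b hY, ← mul_sub, ← sub_pow_char_pow]
    by_cases h0 : a.coeff i - b.coeff i = 0
    · rw [h0, zero_pow (pow_ne_zero _ (Fact.out : p.Prime).ne_zero), mul_zero]; rfl
    · apply HahnSeries.coeff_eq_zero_of_lt_order
      rw [order_twist h0 d s i (Nat.lt_succ_iff.1 i.2)]
      have := h i
      exact mul_pos (pow_pos hp _) (by linarith)
  have h2 : truncMap (s + 1) (HahnSeries.ofPowerSeries ℤ k) (X - Y) = twist k d s (a - b) := by
    rw [map_sub, map_sub, hX, hY]
  intro i
  by_cases h0 : (a - b).coeff i = 0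
  · rw [h0, HahnSeries.order_zero]; simp
  have h3 := order_twist h0 d s i (Nat.lt_succ_iff.1 i.2)
  rw [← e _ _ h2 i] at h3
  set g := (X - Y).coeff i
  have h4 : PowerSeries.constantCoeff g = 0 :=
    (congrArg (TruncatedWittVector.coeff i) h1).trans (TruncatedWittVector.coeff_zero p _ _ i)
  have hg : HahnSeries.ofPowerSeries ℤ k g ≠ 0 := by
    rw [e _ _ h2 i]
    exact mul_ne_zero (pow_ne_zero _ t_ne_zero) (pow_ne_zero _ h0)
  have h5 : 0 < (HahnSeries.ofPowerSeries ℤ k g).order := by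
    by_contra! h6
    apply mt HahnSeries.coeff_order_eq_zero.1 hg
    rcases eq_or_lt_of_le h6 with h7 | h7
    · rw [h7, ← constantCoeff_eq_coeff, h4]
    · exact coeff_of_neg g h7
  rw [h3] at h5
  have h6 := pos_of_mul_pos_right h5 (pow_pos hp _).le
  rw [Nat.cast_sub hd]
  push_cast
  linarith

end FilW

section Comonomial

variable {p : ℕ} [Fact p.Prime] {k : Type*} [Field k] [CharP k p]

theorem coeff_comonomial {m n : ℕ} (l : W p m k) (j : Fin (m + 1)) :
    (comonomial p n l).coeff j =
      const k (l.coeff j) * t k ^ (-((n * p ^ (j : ℕ) : ℕ) : ℤ)) :=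
  TruncatedWittVector.coeff_mk _ _

/-- The comonomials with a given pole are the multiples of the Teichmüller element `[t^{-n}]`. -/
theorem comonomial_truncate {m n : ℕ} (L : WittVector p k) :
    comonomial p n (WittVector.truncate (m + 1) L) = WittVector.truncate (m + 1)
      (WittVector.teichmuller p (t k ^ (-(n : ℤ))) * WittVector.map (const k) L) := by
  ext j
  rw [coeff_comonomial, WittVector.coeff_truncate, WittVector.coeff_truncate,
    coeff_teichmuller_mul, WittVector.map_coeff, mul_comm, ← zpow_natCast, ← zpow_mul]
  push_cast
  rw [neg_mul]

theorem comonomial_add {m n : ℕ} (l l' : W p m k) :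
    comonomial p n (l + l') = comonomial p n l + comonomial p n l' := by
  obtain ⟨l, rfl⟩ := WittVector.truncate_surjective p (m + 1) k l
  obtain ⟨l', rfl⟩ := WittVector.truncate_surjective p (m + 1) k l'
  rw [← map_add, comonomial_truncate, comonomial_truncate, comonomial_truncate, map_add, mul_add,
    map_add]

theorem const_ne_zero {a : k} (ha : a ≠ 0) : const k a ≠ 0 := by simpa using ha

theorem order_const (a : k) : (const k a).order = 0 := HahnSeries.order_C

theorem order_t_zpow (e : ℤ) : (t k ^ e).order = e := by
  have hnat : ∀ n : ℕ, (t k ^ n).order = n := fun n => by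
    rw [HahnSeries.order_pow, order_t]; simp
  obtain ⟨n, rfl | rfl⟩ := e.eq_nat_or_neg
  · rw [zpow_natCast, hnat]
  · have h1 : (t k ^ (-(n : ℤ)) * t k ^ n).order = 0 := by
      rw [zpow_neg, zpow_natCast, inv_mul_cancel₀ (pow_ne_zero _ t_ne_zero), HahnSeries.order_one]
    rw [HahnSeries.order_mul (zpow_ne_zero _ t_ne_zero) (pow_ne_zero _ t_ne_zero), hnat] at h1
    omega

theorem order_const_mul_zpow {a : k} (ha : a ≠ 0) (e : ℤ) : (const k a * t k ^ e).order = e := by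
  rw [HahnSeries.order_mul (const_ne_zero ha) (zpow_ne_zero _ t_ne_zero), order_const,
    order_t_zpow, zero_add]

theorem comonomial_mem_FilW {m : ℕ} (n : ℕ) (l : W p m k) :
    comonomial p n l ∈ FilW p k (n * p ^ m) m := by
  intro j
  rw [coeff_comonomial]
  by_cases h : l.coeff j = 0
  · rw [h, map_zero, zero_mul, HahnSeries.order_zero, mul_zero]
    exact neg_nonpos.2 (Int.natCast_nonneg _)
  · rw [order_const_mul_zpow h]
    have e : p ^ m = p ^ (m - (j : ℕ)) * p ^ (j : ℕ) := by
      rw [← pow_add, Nat.sub_add_cancel (Nat.lt_succ_iff.1 j.2)]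
    rw [e]
    push_cast
    apply le_of_eq
    ring

theorem exists_delta_natCast_mul {m n : ℕ} (hn : 0 < n) (l : W p m k) :
    ∃ y ∈ FilW p k (n * p ^ m - 1) m, delta (E k) m (comonomial p n (p * l)) =
      delta (E k) m y := by
  have hp : 2 ≤ p := (Fact.out : p.Prime).two_le
  obtain ⟨L, rfl⟩ := WittVector.truncate_surjective p (m + 1) k l
  set X := WittVector.teichmuller p (t k ^ (-(n : ℤ))) * WittVector.map (const k) L with hX
  have h1 : comonomial p n ((p : W p m k) * WittVector.truncate (m + 1) L) =
      (p : W p m (E k)) * WittVector.truncate (m + 1) X := by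
    rw [← map_natCast (WittVector.truncate (m + 1)) p, ← map_mul, comonomial_truncate,
      map_mul (WittVector.map (const k)), map_natCast, mul_left_comm, ← hX, map_mul, map_natCast]
  refine ⟨WittVector.truncate (m + 1) (WittVector.verschiebung X), ?_, ?_⟩
  · rintro ⟨i, hi⟩
    rw [WittVector.coeff_truncate]
    cases i with
    | zero => simp
    | succ i =>
      have h2 : X.coeff i = const k (L.coeff i) * t k ^ (-((n * p ^ i : ℕ) : ℤ)) := by
        rw [← WittVector.coeff_truncate X (⟨i, by omega⟩ : Fin (m + 1)), hX, ← comonomial_truncate,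
          coeff_comonomial, WittVector.coeff_truncate]
      simp only [WittVector.verschiebung_coeff_succ]
      rw [h2]
      by_cases h : L.coeff i = 0
      · rw [h, map_zero, zero_mul, HahnSeries.order_zero, mul_zero]
        exact neg_nonpos.2 (Int.natCast_nonneg _)
      · rw [order_const_mul_zpow h]
        have e : p ^ m = p ^ (m - (i + 1)) * p ^ i * p := by
          rw [mul_assoc, ← pow_succ, ← pow_add, Nat.sub_add_cancel (by omega)]
        have e2 : n * p ^ m = p ^ (m - (i + 1)) * (n * p ^ i) * p := by rw [e]; ring
        set q := p ^ (m - (i + 1)) * (n * p ^ i) with hq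
        have hq0 : 0 < q := by positivity
        have h3 : q ≤ n * p ^ m - 1 := by
          rw [e2]
          have : q * 2 ≤ q * p := Nat.mul_le_mul_left _ hp
          omega
        have h4 : (p : ℤ) ^ (m - (i + 1)) * -((n * p ^ i : ℕ) : ℤ) = -(q : ℤ) := by
          rw [hq]; push_cast; ring
        rw [h4]
        omega
  · rw [h1, natCast_mul_truncate, delta_frobenius]

/-- Every class in `Gr_d H¹` that comes from `Fil_d W_s(E)`, `s ≥ m`, is given by a
comonomial. -/
theorem exists_comonomial {n m : ℕ} (hn : 0 < n) (hnp : n.Coprime p) {s : ℕ} (hs : m ≤ s)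
    {f : W p s (E k)} (hf : f ∈ FilW p k (n * p ^ m) s) :
    ∃ l : W p m k, delta (E k) s f - delta (E k) m (comonomial p n l) ∈
      FilH1p p k (n * p ^ m - 1) := by
  have hp : 0 < p := (Fact.out : p.Prime).pos
  have hd : 0 < n * p ^ m := by positivity
  have hmem : ∀ {s : ℕ} {g : W p s (E k)}, g ∈ FilW p k (n * p ^ m - 1) s →
      delta (E k) s g ∈ FilH1p p k (n * p ^ m - 1) := fun {s g} hg =>
    AddSubgroup.mem_iSup_of_mem s (AddSubgroup.mem_map_of_mem _ hg)
  induction s, hs using Nat.le_induction with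
  | base =>
    refine ⟨TruncatedWittVector.mk p fun j =>
      (f.coeff j).coeff (-((n * p ^ (j : ℕ) : ℕ) : ℤ)), ?_⟩
    rw [← map_sub]
    refine hmem (sub_mem_FilW hd hf (comonomial_mem_FilW n _) fun i => ?_)
    rw [coeff_comonomial, TruncatedWittVector.coeff_mk]
    set g := f.coeff i
    set N : ℤ := -((n * p ^ (i : ℕ) : ℕ) : ℤ) with hN
    set q : ℤ := (p : ℤ) ^ (m - (i : ℕ)) with hq
    have hq0 : 0 < q := by rw [hq]; positivity
    have e : -((n * p ^ m : ℕ) : ℤ) = q * N := by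
      have e : p ^ m = p ^ (m - (i : ℕ)) * p ^ (i : ℕ) := by
        rw [← pow_add, Nat.sub_add_cancel (Nat.lt_succ_iff.1 i.2)]
      rw [e, hq, hN]; push_cast; ring
    have h1 : -((n * p ^ m : ℕ) : ℤ) ≤ q * g.order := hf i
    rw [e] at h1 ⊢
    refine mul_lt_mul_of_pos_left ?_ hq0
    have h2 : N ≤ g.order := le_of_mul_le_mul_left h1 hq0
    have hN0 : N < 0 := by
      rw [hN, neg_lt_zero]; exact_mod_cast (by positivity : 0 < n * p ^ (i : ℕ))
    have hcoeff : const k (g.coeff N) * t k ^ N = HahnSeries.single N (g.coeff N) := by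
      have : t k ^ N = HahnSeries.single N 1 := by
        rw [t, ← RatFunc.single_zpow]
      rw [this]
      simp
    rw [hcoeff]
    by_contra! h3
    set z := g - HahnSeries.single N (g.coeff N)
    have hz : z ≠ 0 := by
      intro h0; rw [h0, HahnSeries.order_zero] at h3; omega
    apply mt HahnSeries.coeff_order_eq_zero.1 hz
    rcases eq_or_lt_of_le h3 with h4 | h4
    · rw [h4]; simp [z]
    · rw [HahnSeries.coeff_sub, HahnSeries.coeff_single_of_ne h4.ne,
        HahnSeries.coeff_eq_zero_of_lt_order (lt_of_lt_of_le h4 h2), sub_zero]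
  | succ s hs ih =>
    let f' : W p s (E k) := TruncatedWittVector.mk p fun i => f.coeff i.succ
    have hf' : f' ∈ FilW p k (n * p ^ m) s := by
      intro i
      have := hf i.succ
      rw [Fin.val_succ, Nat.add_sub_add_right] at this
      rwa [TruncatedWittVector.coeff_mk]
    obtain ⟨l, hl⟩ := ih hf'
    refine ⟨l, ?_⟩
    have h1 : f - truncV (s + 1) f' ∈ FilW p k (n * p ^ m - 1) (s + 1) := by
      refine sub_mem_FilW hd hf (truncV_mem_FilW hf') fun i => ?_
      refine Fin.cases ?_ (fun j => ?_) i
      · rw [coeff_truncV_zero, sub_zero]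
        refine lt_of_le_of_ne (hf 0) fun h => ?_
        have h2 : (p : ℤ) * (p ^ (s - m) * -(f.coeff 0).order) = n := by
          have e : p ^ (s + 1) = p ^ (s - m) * p * p ^ m := by
            rw [← pow_succ, ← pow_add]; congr 1; omega
          have hpm : ((p : ℤ) ^ m) ≠ 0 := by positivity
          apply mul_right_cancel₀ hpm
          have e' : (p : ℤ) ^ (s + 1) = p ^ (s - m) * p * p ^ m := by exact_mod_cast e
          simp only [Fin.val_zero, Nat.sub_zero] at h
          push_cast at h
          rw [e'] at h
          linear_combination h
        have h3 : p ∣ n := Int.natCast_dvd_natCast.1 ⟨_, h2.symm⟩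
        have h4 : p ∣ 1 := by rw [← hnp]; exact Nat.dvd_gcd h3 dvd_rfl
        exact (Fact.out : p.Prime).one_lt.ne' (Nat.dvd_one.1 h4)
      · rw [coeff_truncV_succ, TruncatedWittVector.coeff_mk, sub_self, HahnSeries.order_zero,
          mul_zero, neg_lt_zero]
        exact_mod_cast hd
    have h2 := add_mem (hmem h1) hl
    rw [map_sub, delta_truncV] at h2
    rwa [sub_add_sub_cancel] at h2

end Comonomial

section Derivations

variable {R : Type*} [CommRing R]

theorem dd_zero : dd (0 : R) = 0 := map_zero _

theorem dd_one : dd (1 : R) = 0 := Derivation.map_one_eq_zero _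

theorem dd_sum {ι : Type*} (S : Finset ι) (y : ι → R) :
    dd (∑ i ∈ S, y i) = ∑ i ∈ S, dd (y i) := map_sum (KaehlerDifferential.D ℤ R) _ _

theorem dd_mul (a b : R) : dd (a * b) = a • dd b + b • dd a :=
  Derivation.leibniz _ a b

/-- The absolute derivations of a ring. -/
abbrev Der (R : Type*) [CommRing R] : Type _ := Derivation ℤ R R

/-- The derivation given by an additive map that satisfies the Leibniz rule. -/
def mkDer (F : R →+ R) (h : ∀ a b, F (a * b) = a * F b + b * F a) : Der R :=
  Derivation.mk' F.toIntLinearMap h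

/-- The linear form on differentials that corresponds to a derivation. -/
def derForm (D : Der R) : Omega R →ₗ[R] R := D.liftKaehlerDifferential

theorem derForm_dd (D : Der R) (x : R) : derForm D (dd x) = D x :=
  Derivation.liftKaehlerDifferential_comp_D _ _

theorem exists_finsupp_forms (α : Omega R) : ∃ c : R →₀ R, α = c.sum fun a b => b • dd a := by
  have hα : α ∈ Submodule.span R (Set.range (KaehlerDifferential.D ℤ R)) := by
    rw [KaehlerDifferential.span_range_derivation]; trivial
  obtain ⟨c, hc⟩ := (Finsupp.mem_span_range_iff_exists_finsupp).1 hα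
  exact ⟨c, hc.symm⟩

end Derivations

section LogForms

variable {p : ℕ} [Fact p.Prime] {k : Type*} [Field k] [CharP k p] {r : ℕ} {u : Fin r → k}

theorem powerSeries_smul_forms (g : PowerSeries k) (ω : Omega (E k)) :
    g • ω = HahnSeries.ofPowerSeries ℤ k g • ω :=
  algebra_compatible_smul (E k) g ω

theorem coeff_pow_char (g : PowerSeries k) (N : ℕ) :
    PowerSeries.coeff N (g ^ p) =
      if p ∣ N then PowerSeries.coeff (N / p) g ^ p else 0 := by
  have hp : p ≠ 0 := (Fact.out : p.Prime).ne_zero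
  have h : PowerSeries.map (frobenius k p) (PowerSeries.expand p hp g) = g ^ p :=
    MvPowerSeries.map_frobenius_expand p hp
  rw [← h, PowerSeries.coeff_map, PowerSeries.coeff_expand, frobenius_def]
  split_ifs
  · rfl
  · exact zero_pow hp

/-- The monomials `u^s t^j` generate `k[[t]]` over its `p`-th powers. -/
theorem IsPBasis.exists_powerSeries_eq (hu : IsPBasis p u) (g : PowerSeries k) :
    ∃ G : (Fin r → Fin p) → Fin p → PowerSeries k,
      g = ∑ s, ∑ j : Fin p, PowerSeries.C (hu.basis s) * (PowerSeries.X ^ (j : ℕ) * G s j ^ p) := by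
  have hp : 0 < p := (Fact.out : p.Prime).pos
  have h : ∀ (N : ℕ) (s : Fin r → Fin p), ∃ c : k,
      c ^ p = (hu.basis.repr (PowerSeries.coeff N g) s : k) :=
    fun N s => (hu.basis.repr (PowerSeries.coeff N g) s).2
  choose c hc using h
  refine ⟨fun s j => PowerSeries.mk fun M => c (p * M + j) s, ?_⟩
  ext N
  rw [map_sum]
  conv_lhs => rw [← hu.basis.sum_repr (PowerSeries.coeff N g)]
  refine Finset.sum_congr rfl fun s _ => ?_
  rw [map_sum, Finset.sum_eq_single (⟨N % p, Nat.mod_lt _ hp⟩ : Fin p)]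
  · have h1 : N - N % p = p * (N / p) := by
      have := Nat.div_add_mod N p; omega
    rw [PowerSeries.coeff_C_mul, PowerSeries.coeff_X_pow_mul', if_pos (Nat.mod_le _ _),
      coeff_pow_char, h1, if_pos (dvd_mul_right _ _), Nat.mul_div_cancel_left _ hp,
      PowerSeries.coeff_mk]
    simp only [Nat.div_add_mod]
    rw [hc, Subfield.smul_def, smul_eq_mul, mul_comm]
  · intro j _ hj
    rw [PowerSeries.coeff_C_mul, PowerSeries.coeff_X_pow_mul']
    split_ifs with h1
    · rw [coeff_pow_char, if_neg, mul_zero]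
      rintro ⟨q, hq⟩
      apply hj
      apply Fin.ext
      have : N = j + p * q := by omega
      simp [this, Nat.mod_eq_of_lt j.2]
    · exact mul_zero _
  · simp

theorem dlog_t_mem (u : Fin r → k) : dlog (t k) ∈ logForms u :=
  Submodule.subset_span (Or.inr rfl)

theorem ofPowerSeries_smul_mem {g : PowerSeries k} {ω : Omega (E k)} (hω : ω ∈ logForms u) :
    HahnSeries.ofPowerSeries ℤ k g • ω ∈ logForms u := by
  rw [← powerSeries_smul_forms]
  exact Submodule.smul_mem _ _ hω

theorem IsPBasis.dd_const_mem (hu : IsPBasis p u) (a : k) : dd (const k a) ∈ logForms u := by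
  obtain ⟨c, hc⟩ := hu.exists_sum (dd a)
  have h := congrArg (mapForms (const k)) hc
  rw [mapForms_dd, map_sum] at h
  rw [h]
  refine Submodule.sum_mem _ fun i _ => ?_
  rw [mapForms_smul_D, show const k (c i) = HahnSeries.ofPowerSeries ℤ k (PowerSeries.C (c i)) from
    (HahnSeries.ofPowerSeries_C _).symm]
  exact ofPowerSeries_smul_mem (Submodule.subset_span (Or.inl ⟨i, rfl⟩))

theorem IsPBasis.dd_ofPowerSeries_mem (hu : IsPBasis p u) (g : PowerSeries k) :
    dd (HahnSeries.ofPowerSeries ℤ k g) ∈ logForms u := by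
  have hmul : ∀ a b : PowerSeries k, dd (HahnSeries.ofPowerSeries ℤ k a) ∈ logForms u →
      dd (HahnSeries.ofPowerSeries ℤ k b) ∈ logForms u →
      dd (HahnSeries.ofPowerSeries ℤ k (a * b)) ∈ logForms u := by
    intro a b ha hb
    rw [map_mul, dd_mul]
    exact Submodule.add_mem _ (ofPowerSeries_smul_mem hb) (ofPowerSeries_smul_mem ha)
  have hX : dd (HahnSeries.ofPowerSeries ℤ k PowerSeries.X) ∈ logForms u := by
    have h1 : dd (HahnSeries.ofPowerSeries ℤ k PowerSeries.X) =
        HahnSeries.ofPowerSeries ℤ k PowerSeries.X • dlog (t k) := by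
      rw [HahnSeries.ofPowerSeries_X]
      change dd (t k) = t k • (t k)⁻¹ • dd (t k)
      rw [smul_smul, mul_inv_cancel₀ t_ne_zero, one_smul]
    rw [h1]
    exact ofPowerSeries_smul_mem (dlog_t_mem u)
  have hXpow : ∀ j : ℕ, dd (HahnSeries.ofPowerSeries ℤ k (PowerSeries.X ^ j)) ∈ logForms u := by
    intro j
    induction j with
    | zero =>
      rw [pow_zero, map_one, dd_one]
      exact Submodule.zero_mem _
    | succ j ih => rw [pow_succ]; exact hmul _ _ ih hX
  obtain ⟨G, hG⟩ := hu.exists_powerSeries_eq g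
  have h2 : ∀ {ι : Type} (S : Finset ι) (y : ι → PowerSeries k),
      dd (HahnSeries.ofPowerSeries ℤ k (∑ i ∈ S, y i)) =
        ∑ i ∈ S, dd (HahnSeries.ofPowerSeries ℤ k (y i)) := by
    intro ι S y
    rw [map_sum, dd_sum]
  rw [hG, h2]
  refine Submodule.sum_mem _ fun s _ => ?_
  rw [h2]
  refine Submodule.sum_mem _ fun j _ => hmul _ _ ?_ (hmul _ _ (hXpow _) ?_)
  · rw [HahnSeries.ofPowerSeries_C]
    exact hu.dd_const_mem _
  · rw [map_pow, show dd (HahnSeries.ofPowerSeries ℤ k (G s j) ^ p) = 0 from D_pow_p _]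
    exact Submodule.zero_mem _

theorem dlog_mul {L : Type*} [Field L] {a b : L} (ha : a ≠ 0) (hb : b ≠ 0) :
    dlog (a * b) = dlog a + dlog b := by
  simp only [dlog]
  rw [dd_mul, smul_add, smul_smul, smul_smul, add_comm]
  congr 2 <;> field_simp

theorem dlog_zpow {L : Type*} [Field L] {a : L} (ha : a ≠ 0) (e : ℤ) :
    dlog (a ^ e) = (e : L) • dlog a := by
  have h1 : dlog (1 : L) = 0 := by
    rw [dlog, dd_one, smul_zero]
  have hnat : ∀ n : ℕ, dlog (a ^ n) = (n : L) • dlog a := by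
    intro n
    induction n with
    | zero => simp [h1]
    | succ n ih =>
      rw [pow_succ, dlog_mul (pow_ne_zero _ ha) ha, ih]
      push_cast
      rw [add_smul, one_smul]
  obtain ⟨n, rfl | rfl⟩ := e.eq_nat_or_neg
  · rw [zpow_natCast, hnat]; simp
  · have h2 := dlog_mul (zpow_ne_zero (-(n : ℤ)) ha) (pow_ne_zero n ha)
    rw [zpow_neg, zpow_natCast, inv_mul_cancel₀ (pow_ne_zero _ ha), h1, hnat] at h2
    rw [zpow_neg, zpow_natCast, eq_neg_of_add_eq_zero_left h2.symm]
    push_cast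
    rw [neg_smul]

theorem IsPBasis.dlog_mem (hu : IsPBasis p u) {f : E k} (hf : f ≠ 0) : dlog f ∈ logForms u := by
  set g := f.powerSeriesPart with hg
  have hf1 : t k ^ f.order * HahnSeries.ofPowerSeries ℤ k g = f := by
    rw [t, ← RatFunc.single_zpow]
    exact LaurentSeries.single_order_mul_powerSeriesPart f
  have hg0 : PowerSeries.constantCoeff g ≠ 0 := by
    rw [← PowerSeries.coeff_zero_eq_constantCoeff_apply, hg, LaurentSeries.powerSeriesPart_coeff]
    simpa using hf
  have hg1 : g * g⁻¹ = 1 := PowerSeries.mul_inv_cancel g hg0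
  have hg2 : HahnSeries.ofPowerSeries ℤ k g ≠ 0 := by
    intro h0
    rw [h0, mul_zero] at hf1
    exact hf hf1.symm
  have hg3 : (HahnSeries.ofPowerSeries ℤ k g)⁻¹ = HahnSeries.ofPowerSeries ℤ k g⁻¹ := by
    rw [inv_eq_iff_eq_inv]
    refine eq_inv_of_mul_eq_one_left ?_
    rw [← map_mul, hg1, map_one]
  rw [← hf1, dlog_mul (zpow_ne_zero _ t_ne_zero) hg2, dlog_zpow t_ne_zero]
  refine Submodule.add_mem _ ?_ ?_
  · rw [← map_intCast (HahnSeries.ofPowerSeries ℤ k)]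
    exact ofPowerSeries_smul_mem (dlog_t_mem u)
  · rw [dlog, hg3]
    exact ofPowerSeries_smul_mem (hu.dd_ofPowerSeries_mem g)

theorem mem_FilOmega {d : ℕ} {ω : Omega (E k)} :
    ω ∈ FilOmega u d ↔ t k ^ d • ω ∈ logForms u := by
  have h : t k ^ d * t k ^ (-(d : ℤ)) = 1 := by
    rw [zpow_neg, zpow_natCast, mul_inv_cancel₀ (pow_ne_zero _ t_ne_zero)]
  constructor
  · rintro ⟨η, hη, rfl⟩
    change t k ^ d • t k ^ (-(d : ℤ)) • η ∈ _
    rwa [smul_smul, h, one_smul]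
  · intro hω
    refine ⟨_, hω, ?_⟩
    change t k ^ (-(d : ℤ)) • t k ^ d • ω = ω
    rw [smul_smul, mul_comm, h, one_smul]

theorem FilOmega_mono {d d' : ℕ} (h : d ≤ d') : FilOmega u d ≤ FilOmega u d' := by
  intro ω hω
  rw [mem_FilOmega] at hω ⊢
  obtain ⟨e, rfl⟩ := Nat.exists_eq_add_of_le h
  have ht : t k ^ e = HahnSeries.ofPowerSeries ℤ k (PowerSeries.X ^ e) := by
    rw [map_pow, HahnSeries.ofPowerSeries_X]; rfl
  rw [add_comm, pow_add, mul_smul, ht]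
  exact ofPowerSeries_smul_mem hω

theorem IsPBasis.FsD_mem (hu : IsPBasis p u) {d s : ℕ} {f : W p s (E k)}
    (hf : f ∈ FilW p k d s) : FsD s f ∈ FilOmega u d := by
  rw [mem_FilOmega, FsD, Finset.smul_sum]
  refine Submodule.sum_mem _ fun i _ => ?_
  by_cases h0 : f.coeff i = 0
  · rw [h0, dlog, dd_zero, smul_zero, smul_zero, smul_zero]
    exact Submodule.zero_mem _
  rw [smul_smul]
  have h1 : 0 ≤ (t k ^ d * f.coeff i ^ p ^ (s - (i : ℕ))).order := by
    rw [HahnSeries.order_mul (pow_ne_zero _ t_ne_zero) (pow_ne_zero _ h0), HahnSeries.order_pow,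
      HahnSeries.order_pow, order_t]
    have := hf i
    simp only [nsmul_eq_mul, mul_one]
    push_cast
    linarith
  obtain ⟨g, hg⟩ := (order_nonneg_iff _).1 h1
  rw [← hg]
  exact ofPowerSeries_smul_mem (hu.dlog_mem h0)

theorem FsD_comonomial {n m : ℕ} (l : W p m k) :
    FsD m (comonomial p n l) = tForm (n * p ^ m)
      (∑ j : Fin (m + 1), l.coeff j ^ p ^ (m - (j : ℕ)) • dlog (l.coeff j))
      (-(n : k) * l.coeff 0 ^ p ^ m) := by
  have hterm : ∀ j : Fin (m + 1),
      (comonomial p n l).coeff j ^ p ^ (m - (j : ℕ)) • dlog ((comonomial p n l).coeff j) =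
      t k ^ (-((n * p ^ m : ℕ) : ℤ)) •
        (mapForms (const k) (l.coeff j ^ p ^ (m - (j : ℕ)) • dlog (l.coeff j)) +
          if j = 0 then const k (-(n : k) * l.coeff 0 ^ p ^ m) • dlog (t k) else 0) := by
    intro j
    rw [coeff_comonomial]
    set a := l.coeff j with ha
    have hq : p ^ (m - (j : ℕ)) ≠ 0 := pow_ne_zero _ (Fact.out : p.Prime).ne_zero
    by_cases h0 : a = 0
    · have hdl : dlog (0 : E k) = 0 := by
        rw [dlog, dd_zero, smul_zero]
      rw [h0, map_zero, zero_mul, hdl, smul_zero, zero_pow hq, zero_smul, map_zero, zero_add]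
      split_ifs with hj
      · subst hj
        rw [← ha, h0, zero_pow (pow_ne_zero _ (Fact.out : p.Prime).ne_zero), mul_zero, map_zero,
          zero_smul, smul_zero]
      · rw [smul_zero]
    · have e1 : (t k ^ (-((n * p ^ (j : ℕ) : ℕ) : ℤ))) ^ p ^ (m - (j : ℕ)) =
          t k ^ (-((n * p ^ m : ℕ) : ℤ)) := by
        rw [← zpow_natCast, ← zpow_mul]
        congr 1
        have e : p ^ m = p ^ (j : ℕ) * p ^ (m - (j : ℕ)) := by
          rw [← pow_add, Nat.add_sub_cancel' (Nat.lt_succ_iff.1 j.2)]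
        rw [e]; push_cast; ring
      have e2 : mapForms (const k) (a ^ p ^ (m - (j : ℕ)) • dlog a) =
          const k a ^ p ^ (m - (j : ℕ)) • dlog (const k a) := by
        rw [dlog, smul_smul, mapForms_smul_D, dlog, smul_smul, map_mul, map_pow, map_inv₀]
      rw [mul_pow, e1, dlog_mul (const_ne_zero h0) (zpow_ne_zero _ t_ne_zero),
        dlog_zpow t_ne_zero, e2, mul_comm, mul_smul, smul_add]
      congr 2
      split_ifs with hj
      · subst hj
        rw [smul_smul, ← ha]
        congr 1
        rw [map_mul, map_neg, map_natCast, map_pow]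
        push_cast
        rw [Fin.val_zero, pow_zero, mul_one, Nat.sub_zero, mul_comm]
      · have hj' : (j : ℕ) ≠ 0 := fun h => hj (Fin.ext h)
        have : ((-((n * p ^ (j : ℕ) : ℕ) : ℤ) : ℤ) : E k) = 0 := by
          push_cast
          rw [CharP.cast_eq_zero (E k) p, zero_pow hj', mul_zero, neg_zero]
        rw [this, zero_smul, smul_zero]
  rw [FsD, tForm, Finset.sum_congr rfl fun j _ => hterm j, ← Finset.smul_sum,
    Finset.sum_add_distrib, map_sum, Finset.sum_ite_eq' Finset.univ (0 : Fin (m + 1)),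
    if_pos (Finset.mem_univ _)]

end LogForms

section CoeffDer

variable {p : ℕ} [Fact p.Prime] {k : Type*} [Field k] [CharP k p] {r : ℕ} {u : Fin r → k}

/-- The map `∑ a_n t^n ↦ ∑ δ_n(a_n) t^n` on `k((t))`. -/
def coeffHom (δ : ℤ → k →+ k) : E k →+ E k :=
  AddMonoidHom.mk' (fun f => ⟨fun n => δ n (f.coeff n), f.isPWO_support.mono fun n hn h0 => hn (by
    change δ n (f.coeff n) = 0
    rw [show f.coeff n = 0 from h0, map_zero])⟩) fun f g => by
      ext n; exact map_add (δ n) _ _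

theorem coeff_coeffHom (δ : ℤ → k →+ k) (f : E k) (n : ℤ) :
    (coeffHom δ f).coeff n = δ n (f.coeff n) := rfl

/-- The derivation `∑ a_n t^n ↦ ∑ δ_n(a_n) t^n` of `k((t))`. -/
def coeffDer (δ : ℤ → k →+ k)
    (h : ∀ i j a b, δ (i + j) (a * b) = a * δ j b + b * δ i a) : Der (E k) :=
  mkDer (coeffHom δ) fun f g => by
    have hs : ∀ f, (coeffHom δ f).support ⊆ f.support := fun f n hn h0 =>
      hn (by rw [coeff_coeffHom, show f.coeff n = 0 from h0, map_zero])
    ext n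
    rw [coeff_coeffHom, mul_comm g, HahnSeries.coeff_add, HahnSeries.coeff_mul,
      HahnSeries.coeff_mul_right' g.isPWO_support (hs g),
      HahnSeries.coeff_mul_left' f.isPWO_support (hs f), map_sum, ← Finset.sum_add_distrib]
    refine Finset.sum_congr rfl fun ij hij => ?_
    rw [← (Finset.mem_antidiagonal.1 hij).2.2, h, coeff_coeffHom, coeff_coeffHom]
    ring

theorem coeff_coeffDer (δ : ℤ → k →+ k)
    (h : ∀ i j a b, δ (i + j) (a * b) = a * δ j b + b * δ i a) (f : E k) (n : ℤ) :
    (coeffDer δ h f).coeff n = δ n (f.coeff n) := rfl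

theorem coeffDer_single (δ : ℤ → k →+ k)
    (h : ∀ i j a b, δ (i + j) (a * b) = a * δ j b + b * δ i a) (n : ℤ) (a : k) :
    coeffDer δ h (HahnSeries.single n a) = HahnSeries.single n (δ n a) := by
  ext i
  rw [coeff_coeffDer]
  by_cases hi : i = n
  · subst hi; simp
  · rw [HahnSeries.coeff_single_of_ne hi, HahnSeries.coeff_single_of_ne hi, map_zero]

/-- A linear form on `Ω¹_E` that is integral on the generators of the logarithmic forms takes
power series values on them. -/
theorem apply_mem_of_mem_logForms (φ : Omega (E k) →ₗ[E k] E k)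
    (h1 : ∀ i, φ (dd (const k (u i))) ∈ (HahnSeries.ofPowerSeries ℤ k).range)
    (h2 : φ (dlog (t k)) ∈ (HahnSeries.ofPowerSeries ℤ k).range) {ω : Omega (E k)}
    (hω : ω ∈ logForms u) : φ ω ∈ (HahnSeries.ofPowerSeries ℤ k).range := by
  induction hω using Submodule.span_induction with
  | mem x hx =>
    rcases hx with ⟨i, rfl⟩ | rfl
    · exact h1 i
    · exact h2
  | zero => rw [map_zero]; exact zero_mem _
  | add a b _ _ ha hb => rw [map_add]; exact add_mem ha hb
  | smul g a _ ha =>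
    rw [powerSeries_smul_forms, map_smul]
    exact mul_mem ⟨g, rfl⟩ ha

theorem coeff_zero_of_tForm_mem (φ : Omega (E k) →ₗ[E k] E k)
    (h1 : ∀ i, φ (dd (const k (u i))) ∈ (HahnSeries.ofPowerSeries ℤ k).range)
    (h2 : φ (dlog (t k)) ∈ (HahnSeries.ofPowerSeries ℤ k).range) {d : ℕ} (hd : 0 < d)
    {α : Omega k} {β : k} (h : tForm d α β ∈ FilOmega u (d - 1)) :
    (φ (mapForms (const k) α + const k β • dlog (t k))).coeff 0 = 0 := by
  rw [mem_FilOmega, tForm, smul_smul] at h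
  obtain ⟨g, hg⟩ := apply_mem_of_mem_logForms φ h1 h2 h
  obtain ⟨e, rfl⟩ : ∃ e, d = e + 1 := ⟨d - 1, by omega⟩
  set ξ := mapForms (const k) α + const k β • dlog (t k)
  have ht : t k * (t k ^ (e + 1 - 1) * t k ^ (-((e + 1 : ℕ) : ℤ))) = 1 := by
    rw [zpow_neg, zpow_natCast, ← mul_assoc, ← pow_succ',
      Nat.add_sub_cancel, mul_inv_cancel₀ (pow_ne_zero _ t_ne_zero)]
  have h3 : φ ξ = HahnSeries.ofPowerSeries ℤ k (PowerSeries.X * g) := by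
    rw [map_mul, hg, HahnSeries.ofPowerSeries_X, map_smul]
    change _ = t k * (_ * _)
    rw [← mul_assoc, ht, one_mul]
  rw [h3, ← constantCoeff_eq_coeff]
  simp

theorem const_mem_range (a : k) : const k a ∈ (HahnSeries.ofPowerSeries ℤ k).range :=
  ⟨PowerSeries.C a, HahnSeries.ofPowerSeries_C a⟩

/-- `t d/dt`. -/
def tDer (k : Type*) [Field k] : Der (E k) :=
  coeffDer (fun n => n • AddMonoidHom.id k) fun i j a b => by
    simp only [AddMonoidHom.smul_apply, AddMonoidHom.id_apply, zsmul_eq_mul]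
    push_cast
    ring

/-- The derivation `u_i ∂/∂u_i` of `k((t))`. -/
def IsPBasis.derE (hu : IsPBasis p u) (i : Fin r) : Der (E k) :=
  coeffDer (fun _ => (hu.theta i).toAddMonoidHom) fun _ _ a b => hu.theta_mul i a b

theorem IsPBasis.derE_const (hu : IsPBasis p u) (i : Fin r) (a : k) :
    hu.derE i (const k a) = const k (hu.theta i a) :=
  coeffDer_single _ _ 0 a

theorem lift_dlog_t (D : Der (E k)) :
    derForm D (dlog (t k)) = (t k)⁻¹ * D (t k) := by
  rw [dlog, map_smul, derForm_dd, smul_eq_mul]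

theorem IsPBasis.derE_t (hu : IsPBasis p u) (i : Fin r) : hu.derE i (t k) = 0 := by
  refine (coeffDer_single _ _ 1 1).trans ?_
  have : hu.theta i 1 = 0 := by rw [← hu.der_apply]; exact Derivation.map_one_eq_zero _
  change HahnSeries.single 1 (hu.theta i 1) = 0
  rw [this, map_zero]

theorem tDer_t : tDer k (t k) = t k := by
  refine (coeffDer_single _ _ 1 1).trans ?_
  simp [t]

theorem tDer_const (a : k) : tDer k (const k a) = 0 := by
  refine (coeffDer_single _ _ 0 a).trans ?_
  simp

theorem lift_mapForms (D : Der (E k)) (φ : Omega k →ₗ[k] k)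
    (h : ∀ a, D (const k a) = const k (φ (dd a))) (α : Omega k) :
    derForm D (mapForms (const k) α) = const k (φ α) := by
  obtain ⟨c, hc⟩ := exists_finsupp_forms α
  rw [hc, Finsupp.sum, map_sum, map_sum, map_sum, map_sum]
  refine Finset.sum_congr rfl fun a _ => ?_
  rw [mapForms_smul_D, map_smul, map_smul, derForm_dd, h,
    smul_eq_mul, smul_eq_mul, map_mul]

theorem IsPBasis.eq_zero_of_tForm_mem (hu : IsPBasis p u) {d : ℕ} (hd : 0 < d)
    {α : Omega k} {β : k} (h : tForm d α β ∈ FilOmega u (d - 1)) : α = 0 ∧ β = 0 := by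
  have hC0 : ∀ a : k, (const k a).coeff 0 = a := fun a => HahnSeries.coeff_single_same _ _
  constructor
  · refine hu.eq_zero_of_dual fun i => ?_
    have h1 := coeff_zero_of_tForm_mem (derForm (hu.derE i))
      (fun j => by
        rw [derForm_dd, hu.derE_const]; exact const_mem_range _)
      (by rw [lift_dlog_t, hu.derE_t, mul_zero]; exact zero_mem _) hd h
    rw [map_add, map_smul, lift_dlog_t, hu.derE_t, mul_zero, smul_zero, add_zero,
      lift_mapForms _ (hu.dual i) (fun a => by rw [hu.dual_dd, hu.derE_const]), hC0] at h1
    exact h1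
  · have h1 := coeff_zero_of_tForm_mem (derForm (tDer k))
      (fun j => by
        rw [derForm_dd, tDer_const]; exact zero_mem _)
      (by rw [lift_dlog_t, tDer_t, inv_mul_cancel₀ t_ne_zero]; exact one_mem _) hd h
    rw [map_add, map_smul, lift_dlog_t, tDer_t, inv_mul_cancel₀ t_ne_zero, smul_eq_mul, mul_one,
      lift_mapForms _ 0 (fun a => by rw [tDer_const, LinearMap.zero_apply, map_zero]),
      LinearMap.zero_apply, map_zero, zero_add, hC0] at h1
    exact h1

theorem IsPBasis.tForm_inj (hu : IsPBasis p u) {d : ℕ} (hd : 0 < d) {α α' : Omega k} {β β' : k}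
    (h : (QuotientAddGroup.mk (tForm d α β) : Omega (E k) ⧸ FilOmega u (d - 1)) =
      QuotientAddGroup.mk (tForm d α' β')) : α = α' ∧ β = β' := by
  rw [QuotientAddGroup.eq, ← tForm_neg, ← tForm_add] at h
  obtain ⟨h1, h2⟩ := hu.eq_zero_of_tForm_mem hd h
  exact ⟨neg_add_eq_zero.1 h1, neg_add_eq_zero.1 h2⟩

end CoeffDer

section GradedPieces

theorem grMk_eq_iff {A : Type*} [AddCommGroup A] {Fil : ℕ → AddSubgroup A} {d : ℕ}
    {x y : Fil d} : grMk Fil d x = grMk Fil d y ↔ (x : A) - y ∈ Fil (d - 1) := by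
  rw [Subtype.ext_iff]
  change (QuotientAddGroup.mk (x : A) : A ⧸ Fil (d - 1)) = QuotientAddGroup.mk (y : A) ↔ _
  rw [← sub_eq_zero, ← QuotientAddGroup.mk_sub, QuotientAddGroup.eq_zero_iff]

theorem grMk_add {A : Type*} [AddCommGroup A] (Fil : ℕ → AddSubgroup A) (d : ℕ) (x y : Fil d) :
    grMk Fil d (x + y) = grMk Fil d x + grMk Fil d y :=
  Subtype.ext (map_add (QuotientAddGroup.mk' (Fil (d - 1))) (x : A) y)

theorem grMk_surjective {A : Type*} [AddCommGroup A] (Fil : ℕ → AddSubgroup A) (d : ℕ) :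
    Function.Surjective (grMk Fil d) := by
  rintro ⟨_, ⟨x, hx, rfl⟩⟩
  exact ⟨⟨x, hx⟩, rfl⟩

/-- The homomorphism to `Gr_d` given by a homomorphism to `Fil_d`. -/
def grHom {A G : Type*} [AddCommGroup A] [AddCommGroup G] (Fil : ℕ → AddSubgroup A) (d : ℕ)
    (f : G →+ A) (hf : ∀ x, f x ∈ Fil d) : G →+ Gr Fil d :=
  (AddMonoidHom.mk' (grMk Fil d) (grMk_add Fil d)).comp (f.codRestrict (Fil d) hf)

theorem grHom_apply {A G : Type*} [AddCommGroup A] [AddCommGroup G] (Fil : ℕ → AddSubgroup A)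
    (d : ℕ) (f : G →+ A) (hf : ∀ x, f x ∈ Fil d) (x : G) :
    grHom Fil d f hf x = grMk Fil d ⟨f x, hf x⟩ := rfl

theorem grHom_eq_zero_iff {A G : Type*} [AddCommGroup A] [AddCommGroup G]
    {Fil : ℕ → AddSubgroup A} {d : ℕ} {f : G →+ A} {hf : ∀ x, f x ∈ Fil d} {x : G} :
    grHom Fil d f hf x = 0 ↔ f x ∈ Fil (d - 1) := by
  rw [← map_zero (grHom Fil d f hf), grHom_apply, grHom_apply, grMk_eq_iff]
  simp

theorem exists_quotient_addEquiv {R A : Type*} [CommRing R] [AddCommGroup A] (I : Ideal R)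
    (f : R →+ A) (hI : ∀ x, x ∈ I ↔ f x = 0) (hf : Function.Surjective f) :
    ∃ e : R ⧸ I ≃+ A, ∀ x, e (Ideal.Quotient.mk I x) = f x := by
  have hs := Function.surjInv_eq (Ideal.Quotient.mk_surjective (I := I))
  set σ := Function.surjInv (Ideal.Quotient.mk_surjective (I := I))
  have h1 : ∀ x y, Ideal.Quotient.mk I x = Ideal.Quotient.mk I y ↔ f x = f y := by
    intro x y
    rw [Ideal.Quotient.eq, hI, map_sub, sub_eq_zero]
  have h2 : ∀ x, f (σ (Ideal.Quotient.mk I x)) = f x := fun x => (h1 _ _).1 (hs _)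
  refine ⟨AddEquiv.ofBijective (AddMonoidHom.mk' (fun x => f (σ x)) fun x y => ?_) ⟨?_, ?_⟩, h2⟩
  · rw [← map_add]
    exact (h1 _ _).1 (by rw [hs, map_add, hs, hs])
  · intro x y h
    have := (h1 _ _).2 h
    rwa [hs, hs] at this
  · intro a
    obtain ⟨x, rfl⟩ := hf a
    exact ⟨_, h2 x⟩

/-- Graded pieces of two filtered groups `A` and `B` that receive compatible homomorphisms from a
family of groups `G_s`: if `Gr_d A` is generated by the image of a ring `R` in one of them, then it
is a quotient of `R`, and it maps to `Gr_d B`. -/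
theorem exists_graded_maps {A B R S : Type*} {G : S → Type*} [AddCommGroup A] [AddCommGroup B]
    [CommRing R] [∀ s, AddCommGroup (G s)] (I : Ideal R) (FilA : ℕ → AddSubgroup A)
    (FilB : ℕ → AddSubgroup B) (FilG : ∀ s, AddSubgroup (G s)) (d : ℕ) (δ : ∀ s, G s →+ A)
    (φ : ∀ s, G s →+ B) (hδ : ∀ s, ∀ f ∈ FilG s, δ s f ∈ FilA d)
    (hφ : ∀ s, ∀ f ∈ FilG s, φ s f ∈ FilB d)
    (hker : ∀ s s', ∀ f ∈ FilG s, ∀ g ∈ FilG s', δ s f - δ s' g ∈ FilA (d - 1) →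
      φ s f - φ s' g ∈ FilB (d - 1))
    (m : S) (c : R →+ G m) (hc : ∀ l, c l ∈ FilG m)
    (hgen : ∀ χ ∈ FilA d, ∃ l, χ - δ m (c l) ∈ FilA (d - 1))
    (hI : ∀ l ∈ I, δ m (c l) ∈ FilA (d - 1))
    (hI' : ∀ l, φ m (c l) ∈ FilB (d - 1) → l ∈ I) (ε : ℤˣ) :
    ∃ (e : R ⧸ I ≃+ Gr FilA d) (ψ : Gr FilA d →+ Gr FilB d),
      (∀ l, (e (Ideal.Quotient.mk I l) : A ⧸ FilA (d - 1)) = QuotientAddGroup.mk (δ m (c l))) ∧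
      (∀ s f (hf : f ∈ FilG s), (ψ (grMk FilA d ⟨δ s f, hδ s f hf⟩) : B ⧸ FilB (d - 1)) =
        QuotientAddGroup.mk ((ε : ℤ) • φ s f)) ∧
      (∀ ψ' : Gr FilA d →+ Gr FilB d,
        (∀ s f (hf : f ∈ FilG s), (ψ' (grMk FilA d ⟨δ s f, hδ s f hf⟩) : B ⧸ FilB (d - 1)) =
          QuotientAddGroup.mk ((ε : ℤ) • φ s f)) → ψ' = ψ) ∧
      Function.Injective (fun x => ψ (e x)) ∧
      (∀ y : Gr FilB d, y ∈ Set.range (fun x => ψ (e x)) ↔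
        ∃ l, (y : B ⧸ FilB (d - 1)) = QuotientAddGroup.mk (φ m (c l))) ∧
      ∀ l, (ψ (e (Ideal.Quotient.mk I l)) : B ⧸ FilB (d - 1)) =
        QuotientAddGroup.mk ((ε : ℤ) • φ m (c l)) := by
  have hker0 : ∀ l, δ m (c l) ∈ FilA (d - 1) → φ m (c l) ∈ FilB (d - 1) := by
    intro l hl
    have := hker m m (c l) (hc l) 0 (zero_mem _) (by rwa [map_zero, sub_zero])
    rwa [map_zero, sub_zero] at this
  obtain ⟨e, he⟩ := exists_quotient_addEquiv I
    (grHom FilA d ((δ m).comp c) fun l => hδ m _ (hc l))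
    (fun l => by
      rw [grHom_eq_zero_iff]
      exact ⟨fun h => hI l h, fun h => hI' l (hker0 l h)⟩)
    (fun x => by
      obtain ⟨⟨χ, hχ⟩, rfl⟩ := grMk_surjective _ _ x
      obtain ⟨l, hl⟩ := hgen χ hχ
      refine ⟨l, ?_⟩
      rw [grHom_apply, eq_comm, grMk_eq_iff]
      exact hl)
  have hφc : ∀ l, ((ε : ℤ) • (φ m).comp c) l ∈ FilB d := fun l =>
    zsmul_mem (hφ m _ (hc l)) _
  have hε : ∀ x : B, (ε : ℤ) • x ∈ FilB (d - 1) ↔ x ∈ FilB (d - 1) := by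
    intro x
    refine ⟨fun h => ?_, fun h => zsmul_mem h _⟩
    have := zsmul_mem h (ε : ℤ)
    rwa [smul_smul, ← Units.val_mul, Int.units_mul_self, Units.val_one, one_smul] at this
  let Ψ := grHom FilB d ((ε : ℤ) • (φ m).comp c) hφc
  have hΨ : ∀ l ∈ I, Ψ l = 0 := fun l hl =>
    grHom_eq_zero_iff.2 (zsmul_mem (hker0 l (hI l hl)) _)
  let ψ : Gr FilA d →+ Gr FilB d :=
    AddMonoidHom.comp (QuotientAddGroup.lift I.toAddSubgroup Ψ hΨ) e.symm.toAddMonoidHom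
  have hψe : ∀ l, ψ (e (Ideal.Quotient.mk I l)) = Ψ l := by
    intro l
    change QuotientAddGroup.lift I.toAddSubgroup Ψ hΨ (e.symm (e (Ideal.Quotient.mk I l))) = _
    rw [e.symm_apply_apply]
    rfl
  have hgr : ∀ s f (hf : f ∈ FilG s), ∃ l, grMk FilA d ⟨δ s f, hδ s f hf⟩ =
      e (Ideal.Quotient.mk I l) ∧ φ s f - φ m (c l) ∈ FilB (d - 1) := by
    intro s f hf
    obtain ⟨l, hl⟩ := hgen _ (hδ s f hf)
    refine ⟨l, ?_, hker s m f hf _ (hc l) hl⟩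
    rw [he, grHom_apply, grMk_eq_iff]
    exact hl
  refine ⟨e, ψ, fun l => by rw [he]; rfl, ?_, ?_, ?_, ?_, fun l => by rw [hψe]; rfl⟩
  · intro s f hf
    obtain ⟨l, h1, h2⟩ := hgr s f hf
    rw [h1, hψe, eq_comm, ← sub_eq_zero]
    change (QuotientAddGroup.mk ((ε : ℤ) • φ s f) : B ⧸ FilB (d - 1)) -
      QuotientAddGroup.mk ((ε : ℤ) • φ m (c l)) = 0
    rw [← QuotientAddGroup.mk_sub, QuotientAddGroup.eq_zero_iff, ← smul_sub]
    exact zsmul_mem h2 _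
  · intro ψ' h'
    refine AddMonoidHom.ext fun x => Subtype.ext ?_
    obtain ⟨l, rfl⟩ := e.surjective.comp Ideal.Quotient.mk_surjective x
    have h1 := h' m (c l) (hc l)
    have h2 : grMk FilA d ⟨δ m (c l), hδ m _ (hc l)⟩ = e (Ideal.Quotient.mk I l) := by
      rw [he]; rfl
    rw [h2] at h1
    exact h1.trans (by rw [Function.comp_apply, hψe]; rfl)
  · change Function.Injective (ψ.comp e.toAddMonoidHom)
    rw [injective_iff_map_eq_zero]
    intro x hx
    obtain ⟨l, rfl⟩ := Ideal.Quotient.mk_surjective x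
    have h1 : Ψ l = 0 := (hψe l).symm.trans hx
    exact Ideal.Quotient.eq_zero_iff_mem.2 (hI' l ((hε _).1 (grHom_eq_zero_iff.1 h1)))
  · intro y
    constructor
    · rintro ⟨x, rfl⟩
      obtain ⟨l, rfl⟩ := Ideal.Quotient.mk_surjective x
      refine ⟨(ε : ℤ) • l, ?_⟩
      simp only
      rw [hψe, map_zsmul, map_zsmul]
      rfl
    · rintro ⟨l, hl⟩
      refine ⟨Ideal.Quotient.mk I ((ε : ℤ) • l), Subtype.ext ?_⟩
      simp only
      rw [hψe, hl]
      change (QuotientAddGroup.mk ((ε : ℤ) • φ m (c ((ε : ℤ) • l))) : B ⧸ FilB (d - 1)) = _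
      rw [map_zsmul, map_zsmul, smul_smul, ← Units.val_mul, Int.units_mul_self, Units.val_one,
        one_smul]

end GradedPieces

section Characters

variable {p : ℕ} [Fact p.Prime] {k : Type*} [Field k] [CharP k p] {r : ℕ} {u : Fin r → k}

theorem exists_verschiebung_iterate {d s N : ℕ} (h : s ≤ N) {f : W p s (E k)}
    (hf : f ∈ FilW p k d s) : ∃ g ∈ FilW p k d N, delta (E k) N g = delta (E k) s f ∧
      FsD N g = FsD s f := by
  induction N, h using Nat.le_induction with
  | base => exact ⟨f, hf, rfl, rfl⟩
  | succ N _ ih =>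
    obtain ⟨g, hg, h1, h2⟩ := ih
    exact ⟨truncV (N + 1) g, truncV_mem_FilW hg, by rw [delta_truncV, h1], by rw [FsD_truncV, h2]⟩

theorem mem_FilH1p {d : ℕ} {χ : H1 (E k)} :
    χ ∈ FilH1p p k d ↔ ∃ s, ∃ f ∈ FilW p k d s, delta (E k) s f = χ := by
  have hmono : Monotone fun s => (FilW p k d s).map (delta (E k) s) := by
    refine monotone_nat_of_le_succ fun s => ?_
    rintro _ ⟨f, hf, rfl⟩
    exact ⟨truncV (s + 1) f, truncV_mem_FilW hf, delta_truncV s f⟩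
  rw [FilH1p, AddSubgroup.mem_iSup_of_directed hmono.directed_le]
  rfl

theorem pow_nsmul_delta {K : Type*} [Field K] [CharP K p] (s : ℕ) (f : W p s K) :
    p ^ (s + 1) • delta K s f = 0 := by
  refine Subtype.ext (AddMonoidHom.ext fun γ => ?_)
  change p ^ (s + 1) • zmodToQmodZ (p ^ (s + 1)) (aswPeriod K f γ.toMul) = 0
  rw [← map_nsmul, nsmul_eq_mul, CharP.cast_eq_zero, zero_mul, map_zero]

theorem eq_zero_of_mem_primeToP {A : Type*} [AddCommGroup A] {x : A} (h : x ∈ primeToP p A)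
    {M : ℕ} (hM : p ^ M • x = 0) : x = 0 := by
  obtain ⟨N, hN, hx⟩ := h
  have h1 : addOrderOf x ∣ 1 := by
    rw [← Nat.Coprime.pow_right M hN]
    exact Nat.dvd_gcd (addOrderOf_dvd_of_nsmul_eq_zero hx) (addOrderOf_dvd_of_nsmul_eq_zero hM)
  exact AddMonoid.addOrderOf_eq_one_iff.1 (Nat.dvd_one.1 h1)

theorem IsPBasis.FsD_mem_of_delta_mem (hu : IsPBasis p u) {d s : ℕ} (hd : 0 < d)
    {f : W p s (E k)} (hf : f ∈ FilW p k d s) (h : delta (E k) s f ∈ FilH1 p k (d - 1)) :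
    FsD s f ∈ FilOmega u (d - 1) := by
  obtain ⟨χ, hχ, π, hπ, e⟩ := AddSubgroup.mem_sup.1 h
  obtain ⟨s', g, hg, rfl⟩ := mem_FilH1p.1 hχ
  obtain ⟨f', hf', h1, h2⟩ := exists_verschiebung_iterate (le_max_left s s') hf
  obtain ⟨g', hg', h3, h4⟩ := exists_verschiebung_iterate (le_max_right s s') hg
  have hπ' : π = delta (E k) _ (f' - g') := by rw [map_sub, h1, h3, ← e]; abel
  rw [hπ'] at hπ
  obtain ⟨z, hz⟩ := exists_of_delta_eq_zero _ (eq_zero_of_mem_primeToP hπ (pow_nsmul_delta _ _))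
  have h5 : z ∈ FilW p k (d / p) (max s s') := by
    apply mem_FilW_of_wp_mem
    rw [← hz]
    exact sub_mem hf' (FilW_mono (Nat.sub_le _ _) hg')
  have h6 : d / p ≤ d - 1 := by
    have := Nat.div_lt_self hd (Fact.out : p.Prime).one_lt
    omega
  have h7 := congrArg (FsD (max s s')) hz
  rw [FsD_sub, FsD_sub, FsD_frobenius, sub_eq_iff_eq_add] at h7
  rw [← h2, h7]
  exact add_mem (sub_mem (zero_mem _) (FilOmega_mono h6 (hu.FsD_mem h5))) (hu.FsD_mem hg')

theorem IsPBasis.FsD_sub_mem_of_delta_mem (hu : IsPBasis p u) {d s s' : ℕ} (hd : 0 < d)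
    {f : W p s (E k)} (hf : f ∈ FilW p k d s) {g : W p s' (E k)} (hg : g ∈ FilW p k d s')
    (h : delta (E k) s f - delta (E k) s' g ∈ FilH1 p k (d - 1)) :
    FsD s f - FsD s' g ∈ FilOmega u (d - 1) := by
  obtain ⟨f', hf', h1, h2⟩ := exists_verschiebung_iterate (le_max_left s s') hf
  obtain ⟨g', hg', h3, h4⟩ := exists_verschiebung_iterate (le_max_right s s') hg
  rw [← h2, ← h4, ← FsD_sub]
  rw [← h1, ← h3, ← map_sub] at h
  exact hu.FsD_mem_of_delta_mem hd (sub_mem hf' hg') h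

theorem pos_of_coprime {n : ℕ} (hn : n.Coprime p) : 0 < n := by
  rcases Nat.eq_zero_or_pos n with rfl | h
  · rw [Nat.coprime_zero_left] at hn
    exact absurd hn (Fact.out : p.Prime).one_lt.ne'
  · exact h

theorem exists_delta_sub_comonomial_mem {n m : ℕ} (hn : n.Coprime p) {χ : H1 (E k)}
    (hχ : χ ∈ FilH1 p k (n * p ^ m)) : ∃ l : W p m k,
      χ - delta (E k) m (comonomial p n l) ∈ FilH1 p k (n * p ^ m - 1) := by
  obtain ⟨χ', hχ', π, hπ, rfl⟩ := AddSubgroup.mem_sup.1 hχ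
  obtain ⟨s, f, hf, rfl⟩ := mem_FilH1p.1 hχ'
  obtain ⟨g, hg, h1, -⟩ := exists_verschiebung_iterate (le_max_left s m) hf
  obtain ⟨l, hl⟩ := exists_comonomial (pos_of_coprime hn) hn (le_max_right s m) hg
  refine ⟨l, ?_⟩
  rw [h1] at hl
  rw [add_sub_right_comm]
  exact add_mem (AddSubgroup.mem_sup_left hl) (AddSubgroup.mem_sup_right hπ)

/-- `F^s d` as a homomorphism. -/
def FsDHom {K : Type*} [Field K] [CharP K p] (s : ℕ) : W p s K →+ Omega K :=
  AddMonoidHom.mk' (FsD s) (FsD_add s)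

end Characters

section Residue

variable {p : ℕ} [Fact p.Prime] {k : Type*} [Field k] [CharP k p] {r : ℕ} {u : Fin r → k}
  {n m : ℕ}

theorem FsD_comonomial_truncate (L : WittVector p k) :
    FsD m (comonomial p n (WittVector.truncate (m + 1) L)) = tForm (n * p ^ m)
      (wittForm p m L.coeff) (-(n : k) * L.coeff 0 ^ p ^ m) := by
  rw [FsD_comonomial, ← sum_smul_dlog]
  simp

theorem mem_span_natCast {L : WittVector p k} (h0 : L.coeff 0 = 0)
    (h : ∀ i ≤ m, ∃ c, c ^ p = L.coeff i) :
    WittVector.truncate (m + 1) L ∈ Ideal.span {(p : W p m k)} := by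
  choose! c hc using h
  refine Ideal.mem_span_singleton.2
    ⟨WittVector.truncate (m + 1) (WittVector.mk p fun i => c (i + 1)), ?_⟩
  rw [natCast_mul_truncate]
  ext ⟨i, hi⟩
  rw [coeff_truncMap, WittVector.coeff_truncate, WittVector.coeff_truncate, frobenius_def]
  cases i with
  | zero => simp [h0, (Fact.out : p.Prime).ne_zero]
  | succ i =>
    simp only [WittVector.verschiebung_coeff_succ, WittVector.coeff_mk]
    exact (hc (i + 1) (by omega)).symm

theorem natCast_ne_zero_of_coprime (hn : n.Coprime p) : (n : k) ≠ 0 := by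
  intro h
  have h1 := (CharP.cast_eq_zero_iff k p n).1 h
  have h2 : p ∣ 1 := by rw [← hn]; exact Nat.dvd_gcd h1 dvd_rfl
  exact (Fact.out : p.Prime).one_lt.ne' (Nat.dvd_one.1 h2)

theorem mul_pow_pos (hn : n.Coprime p) : 0 < n * p ^ m :=
  Nat.mul_pos (pos_of_coprime hn) (pow_pos (Fact.out : p.Prime).pos _)

/-- The form of a comonomial determines it modulo `p`. -/
theorem IsPBasis.mem_span_of_FsD_mem (hu : IsPBasis p u) (hn : n.Coprime p) {l : W p m k}
    (h : FsD m (comonomial p n l) ∈ FilOmega u (n * p ^ m - 1)) :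
    l ∈ Ideal.span {(p : W p m k)} := by
  obtain ⟨L, rfl⟩ := WittVector.truncate_surjective p (m + 1) k l
  rw [FsD_comonomial_truncate] at h
  obtain ⟨h1, h2⟩ := hu.eq_zero_of_tForm_mem (mul_pow_pos hn) h
  refine mem_span_natCast ?_ (hu.eq_pow_of_wittForm h1)
  exact pow_eq_zero_iff (pow_ne_zero _ (Fact.out : p.Prime).ne_zero) |>.1
    ((mul_eq_zero.1 h2).resolve_left (neg_ne_zero.2 (natCast_ne_zero_of_coprime hn)))

theorem FsD_comonomial_sub (l l' : W p m k) :
    FsD m (comonomial p n (l - l')) = FsD m (comonomial p n l) - FsD m (comonomial p n l') := by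
  rw [eq_sub_iff_add_eq, ← FsD_add, ← comonomial_add, sub_add_cancel]

theorem delta_comonomial_mem (hn : n.Coprime p) {l : W p m k}
    (h : l ∈ Ideal.span {(p : W p m k)}) :
    delta (E k) m (comonomial p n l) ∈ FilH1 p k (n * p ^ m - 1) := by
  obtain ⟨x, rfl⟩ := Ideal.mem_span_singleton.1 h
  obtain ⟨y, hy, e⟩ := exists_delta_natCast_mul (pos_of_coprime hn) x
  rw [e]
  exact delta_mem_FilH1 p k hy

theorem IsPBasis.exists_isNormalized (hu : IsPBasis p u) (hn : n.Coprime p) (l : W p m k) :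
    ∃ l' : W p m k, IsNormalized p u l' ∧
      FsD m (comonomial p n l') = FsD m (comonomial p n l) ∧
      (Ideal.Quotient.mk (Ideal.span {(p : W p m k)}) l') = Ideal.Quotient.mk _ l := by
  obtain ⟨L, rfl⟩ := WittVector.truncate_surjective p (m + 1) k l
  obtain ⟨y, hy, h0, h⟩ := hu.exists_normalized m L.coeff
  have e : FsD m (comonomial p n (WittVector.truncate (m + 1) (WittVector.mk p y))) =
      FsD m (comonomial p n (WittVector.truncate (m + 1) L)) := by
    rw [FsD_comonomial_truncate, FsD_comonomial_truncate]
    change tForm _ (wittForm p m y) (-(n : k) * y 0 ^ p ^ m) = _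
    rw [h, h0]
  refine ⟨WittVector.truncate (m + 1) (WittVector.mk p y), ?_, e, ?_⟩
  · intro j hj
    rw [WittVector.coeff_truncate, WittVector.coeff_mk]
    exact hy _ fun h => hj (Fin.ext h)
  · rw [Ideal.Quotient.eq]
    apply hu.mem_span_of_FsD_mem hn
    rw [FsD_comonomial_sub, e, sub_self]
    exact zero_mem _

theorem IsPBasis.eq_of_isNormalized (hu : IsPBasis p u) (hn : n.Coprime p) {l l' : W p m k}
    (hl : IsNormalized p u l) (hl' : IsNormalized p u l')
    (h : (QuotientAddGroup.mk (FsD m (comonomial p n l)) :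
      Omega (E k) ⧸ FilOmega u (n * p ^ m - 1)) =
      QuotientAddGroup.mk (FsD m (comonomial p n l'))) : l = l' := by
  obtain ⟨L, rfl⟩ := WittVector.truncate_surjective p (m + 1) k l
  obtain ⟨L', rfl⟩ := WittVector.truncate_surjective p (m + 1) k l'
  rw [FsD_comonomial_truncate, FsD_comonomial_truncate] at h
  obtain ⟨h1, h2⟩ := hu.tForm_inj (mul_pow_pos hn) h
  have h3 : L.coeff 0 = L'.coeff 0 := by
    apply (iterateFrobenius k p m).injective
    exact mul_left_cancel₀ (neg_ne_zero.2 (natCast_ne_zero_of_coprime hn)) h2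
  have hN : ∀ M : WittVector p k, IsNormalized p u (WittVector.truncate (m + 1) M) →
      ∀ i ≤ m, i ≠ 0 → M.coeff i ∈ kPrime p u := by
    intro M hM i hi h0
    have := hM ⟨i, by omega⟩ fun h => h0 (congrArg Fin.val h)
    rwa [WittVector.coeff_truncate] at this
  have h4 := hu.eq_of_wittForm_eq (hN L hl) (hN L' hl') h3 h1
  ext ⟨i, hi⟩
  rw [WittVector.coeff_truncate, WittVector.coeff_truncate]
  exact h4 i (by omega)

theorem mem_BGr_iff (hn : n.Coprime p)
    (y : Gr (FilOmega u) (n * p ^ m)) :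
    y ∈ BGr p u n m ↔ ∃ l : W p m k, (y : Omega (E k) ⧸ FilOmega u (n * p ^ m - 1)) =
      QuotientAddGroup.mk (FsD m (comonomial p n l)) := by
  have hn0 := natCast_ne_zero_of_coprime (k := k) hn
  have hpow : ∀ b : k, (-(n : k) * b) ^ p ^ m = -(n : k) * b ^ p ^ m := by
    intro b
    rw [← iterateFrobenius_def, ← iterateFrobenius_def, map_mul, map_neg, map_natCast]
  have hdd : ∀ b : k, dd (-(n : k) * b) = -((n : k) • dd b) := by
    intro b
    rw [neg_mul, show dd (-((n : k) * b)) = -dd ((n : k) * b) from map_neg _ _, dd_mul,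
      show dd (n : k) = 0 from Derivation.map_natCast _ _, smul_zero, add_zero]
  constructor
  · rintro ⟨α, η, a, -, h2, h3, h4⟩
    have ha : a = -(n : k) * (-(a / n)) := by field_simp
    have hη : η = dd (-(a / n)) := by
      rw [ha, hdd, ← Nat.cast_smul_eq_nsmul k, ← sub_eq_add_neg, ← smul_sub] at h3
      exact sub_eq_zero.1 ((smul_eq_zero.1 h3).resolve_left hn0)
    rw [hη] at h2
    obtain ⟨x, hx, rfl⟩ := exists_wittForm_of_isCartierIter h2
    refine ⟨WittVector.truncate (m + 1) (WittVector.mk p x), ?_⟩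
    rw [FsD_comonomial_truncate, h4]
    change _ = QuotientAddGroup.mk (tForm _ (wittForm p m x) (-(n : k) * x 0 ^ p ^ m))
    rw [hx, ← hpow, ← ha]
  · rintro ⟨l, hl⟩
    obtain ⟨L, rfl⟩ := WittVector.truncate_surjective p (m + 1) k l
    refine ⟨wittForm p m L.coeff, dd (L.coeff 0), -(n : k) * L.coeff 0,
      wittForm_mem_BForms m _, isCartierIter_wittForm m _, ?_, ?_⟩
    · rw [hdd, ← Nat.cast_smul_eq_nsmul k, add_neg_cancel]
    · rw [hl, FsD_comonomial_truncate, hpow]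

end Residue

end RefinedSwan

end

open RefinedSwan in
/-- The explicit description of the refined Swan map `ψ_d`, `d = np^m > 0`, `(n, p) = 1`, in terms of
Witt vectors over `k`. Here `ε = ±1` is the sign in the normalization
`ψ_d ∘ gr_d(δ) = ε · gr_d(F^s d)` of `ψ_d`. -/
theorem theorem5 (p : ℕ) [Fact p.Prime] (k : Type*) [Field k] [CharP k p]
    (r : ℕ) (u : Fin r → k) (hu : RefinedSwan.IsPBasis p u)
    (n m : ℕ) (hn : n.Coprime p) (ε : ℤˣ) :
    ∃ (δbar : (RefinedSwan.W p m k ⧸ Ideal.span {(p : RefinedSwan.W p m k)}) ≃+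
          RefinedSwan.Gr (RefinedSwan.FilH1 p k) (n * p ^ m))
      (ψ : RefinedSwan.Gr (RefinedSwan.FilH1 p k) (n * p ^ m) →+
          RefinedSwan.Gr (RefinedSwan.FilOmega u) (n * p ^ m)),
      -- `δbar` is the isomorphism given by co-monomials
      RefinedSwan.IsDeltaBar p k n m δbar ∧
      -- `ψ` is the refined Swan map, the unique one with its defining property
      RefinedSwan.IsRefinedSwan p u ε (n * p ^ m) ψ ∧
      (∀ ψ', RefinedSwan.IsRefinedSwan p u ε (n * p ^ m) ψ' → ψ' = ψ) ∧
      -- the composite is an isomorphism onto `B Gr_d Ω¹_E`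
      Function.Injective (fun x => ψ (δbar x)) ∧
      Set.range (fun x => ψ (δbar x)) = RefinedSwan.BGr p u n m ∧
      -- every element of the source has a unique normalized representative
      (∀ x : RefinedSwan.W p m k ⧸ Ideal.span {(p : RefinedSwan.W p m k)},
        ∃! l : RefinedSwan.W p m k,
          RefinedSwan.IsNormalized p u l ∧ Ideal.Quotient.mk _ l = x) ∧
      -- the value of the composite on normalized representatives
      (∀ l : RefinedSwan.W p m k, RefinedSwan.IsNormalized p u l →
        (ψ (δbar (Ideal.Quotient.mk _ l)) :
            RefinedSwan.Omega (RefinedSwan.E k) ⧸ RefinedSwan.FilOmega u (n * p ^ m - 1)) =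
          QuotientAddGroup.mk ((ε : ℤ) • RefinedSwan.tForm (n * p ^ m)
            (∑ j : Fin (m + 1), l.coeff j ^ p ^ (m - (j : ℕ)) • RefinedSwan.dlog (l.coeff j))
            (-(n : k) * l.coeff 0 ^ p ^ m))) ∧
      -- every element of `B Gr_d Ω¹_E` has a unique expression of this form
      (∀ y ∈ RefinedSwan.BGr p u n m, ∃! l : RefinedSwan.W p m k,
        RefinedSwan.IsNormalized p u l ∧
        (y : RefinedSwan.Omega (RefinedSwan.E k) ⧸ RefinedSwan.FilOmega u (n * p ^ m - 1)) =
          QuotientAddGroup.mk (RefinedSwan.tForm (n * p ^ m)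
            (∑ j : Fin (m + 1), l.coeff j ^ p ^ (m - (j : ℕ)) • RefinedSwan.dlog (l.coeff j))
            (-(n : k) * l.coeff 0 ^ p ^ m))) := by
  have hd : 0 < n * p ^ m := mul_pow_pos hn
  have maps := exists_graded_maps (A := H1 (E k)) (B := Omega (E k))
    (G := fun s => W p s (E k)) (Ideal.span {(p : W p m k)}) (FilH1 p k) (FilOmega u)
    (fun s => FilW p k (n * p ^ m) s) (n * p ^ m) (fun s => delta (E k) s) (fun s => FsDHom s)
    (fun _ _ hf => delta_mem_FilH1 p k hf) (fun _ _ hf => hu.FsD_mem hf)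
  have maps' := maps (fun _ _ _ hf _ hg h => hu.FsD_sub_mem_of_delta_mem hd hf hg h) m
    (AddMonoidHom.mk' (comonomial p n) comonomial_add) (comonomial_mem_FilW n)
    (fun _ hχ => exists_delta_sub_comonomial_mem hn hχ)
    (fun _ hl => delta_comonomial_mem hn hl) (fun _ hl => hu.mem_span_of_FsD_mem hn hl) ε
  obtain ⟨δbar, ψ, h1, h2, h3, h4, h5, h6⟩ := maps'
  refine ⟨δbar, ψ, h1, h2, h3, h4, ?_, ?_, ?_, ?_⟩
  · ext y
    exact (h5 y).trans (mem_BGr_iff hn y).symm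
  · intro x
    obtain ⟨l, rfl⟩ := Ideal.Quotient.mk_surjective x
    obtain ⟨l', hl', -, hmk⟩ := hu.exists_isNormalized hn l
    refine ⟨l', ⟨hl', hmk⟩, fun l'' h => hu.eq_of_isNormalized hn h.1 hl' ?_⟩
    have h7 := delta_comonomial_mem hn (Ideal.Quotient.eq.1 (h.2.trans hmk.symm))
    have h8 := hu.FsD_mem_of_delta_mem hd (comonomial_mem_FilW n _) h7
    rw [FsD_comonomial_sub] at h8
    rw [← sub_eq_zero, ← QuotientAddGroup.mk_sub, QuotientAddGroup.eq_zero_iff]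
    exact h8
  · intro l _
    rw [h6 l, ← FsD_comonomial]
    rfl
  · intro y hy
    simp only [← FsD_comonomial]
    obtain ⟨l, hl⟩ := (mem_BGr_iff hn y).1 hy
    obtain ⟨l', hl', e, -⟩ := hu.exists_isNormalized hn l
    refine ⟨l', ⟨hl', by rw [hl, e]⟩, fun l'' h => hu.eq_of_isNormalized hn h.1 hl' ?_⟩
    rw [← h.2, hl, e]
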